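/- Let $\mathbb F$ be a field, $V$ and $U$ vector spaces over $\mathbb F$, and $K\ge 1$, $N,S,A,T\ge 0$ integers; $V$ is assumed finite whenever $T>0$. The task is to compute $f(X_1),\dots,f(X_K)$ for a nonconstant $f:V\to U$ of degree $d$, with inputs $X_j\in V$, using $N$ workers. A *linear encoding* consists of an integer $c\ge 0$ and coefficients $G_{ij},H_{il}\in\mathbb F$; worker $i$ stores $\tilde X_i=\sum_{j=1}^K G_{ij}X_j+\sum_{l=1}^c H_{il}Z_l$, where $Z_1,\dots,Z_c$ are independent uniformly random keys in $V$ (keys are used only if $V$ is finite), and computes $f(\tilde X_i)$. It is *$T$-private* if $I\big(X;(\tilde X_i)_{i\in\mathcal T}\big)=0$ for every set $\mathcal T$ of at most $T$ workers, $X=(X_1,\dots,X_K)$ being uniform and independent of the keys. A *decoder* assigns to every set $\mathcal R$ of responding workers a function $h_{\mathcal R}:U^{\mathcal R}\to U^K$, deterministic or random but independent of the inputs and keys; it is *linear* if every output of $h_{\mathcal R}$ is a linear combination of the workers' results with coefficients in $\mathbb F$. A linear encoding *achieves* $(S,A,T)$ (with decoders of a given class) if it is $T$-private and some decoder of the class always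 (almost surely in its own randomness) returns $f(X_1),\dots,f(X_K)$ from the results of any set $\mathcal R$ with $|\mathcal R|\ge N-S$, even if up to $A$ of the results in $\mathcal R$ are replaced by arbitrary values. *Lagrange coded computing* (LCC) is the linear encoding $\tilde X_i=u(\alpha_i)$, where $u$ is the polynomial of degree at most $K+T-1$ with $u(\beta_j)=X_j$ for $j\le K$ and $u(\beta_{K+l})=Z_l$ for $1\le l\le T$, the $\beta$'s being distinct. In its standard form, used when $T>0$ or $N\ge Kd-1$, the $\alpha_i$ are distinct and, if $T>0$, different from $\beta_1,\dots,\beta_K$. In its uncoded (repetition) form, used otherwise, the $\alpha_i$ are taken in $\{\beta_1,\dots,\beta_K\}$ so that each $X_j$ is stored by $\lfloor N/K\rfloor$ to $\lceil N/K\rceil$ workers. Call *region condition* the inequality $$(K+T-1)d+S+2A+1\le N\ \text{ if } T>0 \text{ or } N\ge Kd-1,\qquad K(S+2A+1)\le N\ \text{ otherwise.}$$ **Theorem.** (a) Let $V=W_1\times\cdots\times W_d$ with $d\ge1$ and let $f$ be a nonzero multilinear map of its $d$ entries. If some linear encoding achieves $(S,A,T)$ with arbitrary decoders, then the region condition holds;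 conversely, if the region condition holds, then LCC, with any admissible choice of points in $\mathbb F$, achieves $(S,A,T)$. In particular, if $|\mathbb F|\ge N+K+T$, then admissible points exist and LCC achieves every $(S,A,T)$ achieved by some linear encoding. (b) Let $V,U$ be finite dimensional, and let $f$ be any nonconstant polynomial map of total degree $d$ (in the canonical representation, with individual degrees at most $|\mathbb F|-1$, if $\mathbb F$ is finite), where $\operatorname{char}\mathbb F$ is $0$ or greater than $d$. Then all statements of (a) hold for $f$ with $A=0$ and with linear decoders in place of arbitrary ones. -/

import Mathlib

universe u v v' w

namespace CodedComputing

open MeasureTheory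

/-- A linear encoding of `K` inputs for `N` workers: worker `i` stores a linear combination of the
inputs and of `numKeys` random keys, with fixed coefficients in `F`. -/
structure LinearEncoder (F : Type*) (K N : ℕ) where
  /-- the number of random keys -/
  numKeys : ℕ
  /-- the coefficient of each input at each worker -/
  dataCoeff : Fin N → Fin K → F
  /-- the coefficient of each key at each worker -/
  keyCoeff : Fin N → Fin numKeys → F

/-- A family of (deterministic) decoding functions, one for each set of responding workers. -/
abbrev Decoder (K N : ℕ) (U : Type*) : Type _ :=
  (R : Finset (Fin N)) → (R → U) → Fin K → U

/-- A decoder is linear when every output is a linear combination, with coefficients in `F`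
depending only on the set of responding workers, of the returned results. -/
def linearDecoders (F : Type*) [Field F] (K N : ℕ) (U : Type*) [AddCommGroup U] [Module F U] :
    Set (Decoder K N U) :=
  {h | ∀ R : Finset (Fin N), ∃ c : Fin K → R → F, ∀ (y : R → U) (k : Fin K),
    h R y k = ∑ i, c k i • y i}

/-- Mutual information of two random variables: the Kullback-Leibler divergence of their joint
law from the product of their laws. -/
noncomputable def mutualInfo {Ω α β : Type*} [MeasurableSpace Ω] [MeasurableSpace α]
    [MeasurableSpace β] (P : Measure Ω) (X : Ω → α) (Y : Ω → β) : ENNReal :=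
  InformationTheory.klDiv (P.map fun ω => (X ω, Y ω)) ((P.map X).prod (P.map Y))

namespace LinearEncoder

variable {F : Type*} [Field F] {K N : ℕ}

/-- The coded data stored at worker `i`, for inputs `X` and keys `Z`. -/
def encode (E : LinearEncoder F K N) {V : Type*} [AddCommGroup V] [Module F V]
    (X : Fin K → V) (Z : Fin E.numKeys → V) (i : Fin N) : V :=
  ∑ j, E.dataCoeff i j • X j + ∑ l, E.keyCoeff i l • Z l

/-- `T`-privacy over a finite space `V`: the inputs and the keys being independent and uniform, the
data stored at any set of at most `T` workers has zero mutual information with the inputs. -/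
def IsPrivate (E : LinearEncoder F K N) (V : Type*) [AddCommGroup V] [Module F V] (T : ℕ) : Prop :=
  letI : MeasurableSpace V := ⊤
  ∀ C : Finset (Fin N), C.card ≤ T →
    mutualInfo
      (ProbabilityTheory.uniformOn (Set.univ : Set ((Fin K → V) × (Fin E.numKeys → V))))
      Prod.fst
      (fun ω (i : C) => E.encode ω.1 ω.2 (i : Fin N)) = 0

/-- The random decoder `h` (with randomness `P`, not depending on the inputs and the keys) always
recovers `f (X 1), …, f (X K)` although at most `S` workers do not respond and at most `A` of the
responding workers return arbitrary results: `R` is the set of responding workers, and `y i` is what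
worker `i` returns. -/
def Decodes (E : LinearEncoder F K N) {V U : Type*} [AddCommGroup V] [Module F V]
    (f : V → U) (S A : ℕ) {Ω : Type*} [MeasurableSpace Ω] (P : Measure Ω)
    (h : Ω → Decoder K N U) : Prop :=
  ∀ (X : Fin K → V) (Z : Fin E.numKeys → V) (R : Finset (Fin N)), N ≤ R.card + S →
    ∀ y : R → U, {i : R | y i ≠ f (E.encode X Z i)}.ncard ≤ A →
      ∀ᵐ ω ∂P, h ω R y = fun k => f (X k)

/-- The encoder `E`, together with some (possibly random) decoder taken from the class `D`, is an
`S`-resilient, `A`-secure and `T`-private scheme for computing `f`. Uniform keys make sense only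
over a finite space. -/
def Achieves (E : LinearEncoder F K N) {V U : Type*} [AddCommGroup V] [Module F V]
    (D : Set (Decoder K N U)) (f : V → U) (S A T : ℕ) : Prop :=
  (E.numKeys ≠ 0 → Finite V) ∧ E.IsPrivate V T ∧
    ∃ (Ω : Type w) (_ : MeasurableSpace Ω) (P : Measure Ω) (h : Ω → Decoder K N U),
      IsProbabilityMeasure P ∧ (∀ ω, h ω ∈ D) ∧ E.Decodes f S A P h

end LinearEncoder

section LCC

variable {F : Type*} [Field F] {K N T : ℕ}

/-- The Lagrange encoder: worker `i` stores `u (α i)`, where `u` is the interpolation polynomial of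
degree at most `K + T - 1` that takes the inputs as values at the first `K` nodes `β` and the `T`
keys as values at the other nodes. -/
noncomputable def lagrangeEncoder (α : Fin N → F) (β : Fin K ⊕ Fin T → F) :
    LinearEncoder F K N where
  numKeys := T
  dataCoeff i j := (Lagrange.basis Finset.univ β (Sum.inl j)).eval (α i)
  keyCoeff i l := (Lagrange.basis Finset.univ β (Sum.inr l)).eval (α i)

/-- Points of the standard form of Lagrange coded computing. -/
def IsStandardPoints (α : Fin N → F) (β : Fin K ⊕ Fin T → F) : Prop :=
  Function.Injective α ∧ Function.Injective β ∧ (0 < T → ∀ i j, α i ≠ β (Sum.inl j))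

/-- Points of the uncoded form of Lagrange coded computing: the evaluation points are taken among
the first `K` nodes, so that each input is replicated at `⌊N / K⌋` to `⌈N / K⌉` workers. -/
def IsUncodedPoints (α : Fin N → F) (β : Fin K ⊕ Fin T → F) : Prop :=
  Function.Injective β ∧ ∃ σ : Fin N → Fin K, (∀ i, α i = β (Sum.inl (σ i))) ∧
    ∀ j, N / K ≤ {i | σ i = j}.ncard ∧ {i | σ i = j}.ncard ≤ N ⌈/⌉ K

/-- Points of Lagrange coded computing for a function of degree `d`: the standard form is used when
`T > 0` or `N ≥ K d - 1`, and the uncoded form otherwise. -/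
def IsLCCPoints (d : ℕ) (α : Fin N → F) (β : Fin K ⊕ Fin T → F) : Prop :=
  if 0 < T ∨ K * d ≤ N + 1 then IsStandardPoints α β else IsUncodedPoints α β

/-- The region of the triples `(S, A, T)`, given `N` workers, `K > 0` inputs and degree `d`. -/
def InRegion (N K d S A T : ℕ) : Prop :=
  if 0 < T ∨ K * d ≤ N + 1 then (K + T - 1) * d + S + 2 * A + 1 ≤ N
  else K * (S + 2 * A + 1) ≤ N

end LCC

section Polynomial

variable {F V U : Type*} [Field F] [AddCommGroup V] [Module F V] [AddCommGroup U] [Module F U]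
  {M L : ℕ}

/-- The map `V → U` whose coordinates are given by the polynomials `p`. -/
noncomputable def polyMap (b : Module.Basis (Fin M) F V) (c : Module.Basis (Fin L) F U)
    (p : Fin L → MvPolynomial (Fin M) F) (v : V) : U :=
  ∑ l, MvPolynomial.eval (fun m => b.repr v m) (p l) • c l

/-- The canonical representation of polynomials over a finite field: every individual degree is at
most `|F| - 1`. -/
def IsCanonical (p : Fin L → MvPolynomial (Fin M) F) : Prop :=
  Finite F → ∀ l m, (p l).degreeOf m ≤ Nat.card F - 1

/-- The total degree of a tuple of polynomials. -/
noncomputable def polyDegree (p : Fin L → MvPolynomial (Fin M) F) : ℕ :=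
  Finset.univ.sup fun l => (p l).totalDegree

end Polynomial

end CodedComputing

/-
The data stored by a worker is a vector of coefficients with respect to the inputs and keys. If `d`
subspaces cover the vectors of the workers in `R` and none of them contains the vector `e j` of the
`j`-th input, then there are `d` functionals, all equal to `1` at `e j`, whose product vanishes at
the workers of `R`. For multilinear `f`, a choice of inputs and keys realizes these functionals, so
that the results of `R` are those for zero inputs although the `j`-th output is not. For polynomial
`f` and linear decoders, a finite difference of order `d` of the decoding identity gives the same
contradiction; there `d !` has to be invertible.

Outside the region such a covering exists for some `j` and some `R` that misses at most `S + 2 * A`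
workers. Without privacy one splits off bases greedily. With privacy, a set of workers whose span
contains `m > 0` of the input vectors has rank at least `m + T`; counting against this bound gives
an `e j` outside the spans of all tight subsets of a maximal sparse set of workers, and Edmonds'
covering theorem in the quotient by `e j` yields the subspaces.

Conversely, the composition of `f` with the Lagrange curve is a polynomial curve of degree at most
`(K + T - 1) * d`, which interpolation recovers from any `(K + T - 1) * d + 1` of its values.
-/

namespace CodedComputing

open Module Submodule Finset MeasureTheory ProbabilityTheory

section Rank

variable {F W ι : Type*} [Field F] [AddCommGroup W] [Module F W]

theorem finrank_image_eq_card {v : ι → W} {I : Finset ι}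
    (h : LinearIndepOn F v (I : Set ι)) : Set.finrank F (v '' I) = #I := by
  rw [Set.finrank, Set.image_eq_range]
  exact (finrank_span_eq_card h.linearIndependent).trans (Fintype.card_coe I)

theorem exists_linearIndepOn_span_image_eq (v : ι → W) (I : Finset ι) :
    ∃ B ⊆ I, LinearIndepOn F v (B : Set ι) ∧ span F (v '' B) = span F (v '' I) := by
  obtain ⟨B, hBI, -, hspan, hB⟩ := exists_linearIndepOn_extension
    (linearIndepOn_empty F v) (Set.empty_subset (I : Set ι))
  lift B to Finset ι using I.finite_toSet.subset hBI
  exact ⟨B, mod_cast hBI, hB, le_antisymm (span_mono (Set.image_mono hBI)) (span_le.2 hspan)⟩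

variable [FiniteDimensional F W]

theorem finrank_union_add_finrank_inter_le (s t : Set W) :
    Set.finrank F (s ∪ t) + Set.finrank F (s ∩ t) ≤ Set.finrank F s + Set.finrank F t := by
  have hinf : span F (s ∩ t) ≤ span F s ⊓ span F t :=
    le_inf (span_mono Set.inter_subset_left) (span_mono Set.inter_subset_right)
  calc Set.finrank F (s ∪ t) + Set.finrank F (s ∩ t)
      ≤ finrank F (span F s ⊔ span F t : Submodule F W) +
          finrank F (span F s ⊓ span F t : Submodule F W) :=
        add_le_add (congrArg (fun p : Submodule F W => finrank F p) (span_union s t)).le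
          (finrank_mono hinf)
    _ = Set.finrank F s + Set.finrank F t := finrank_sup_add_finrank_inf_eq _ _

end Rank

section Rado

variable {F W ι : Type*} [Field F] [AddCommGroup W] [Module F W]

variable (F) in
/-- Rado's condition on a family of finite sets of vectors, which characterizes the families that
have a linearly independent system of representatives. -/
def RadoCondition (A : ι → Finset W) : Prop :=
  ∀ J : Finset ι, #J ≤ Set.finrank F (⋃ i ∈ J, (A i : Set W))

variable [FiniteDimensional F W]

theorem RadoCondition.update_erase_or_update_erase [DecidableEq ι] [DecidableEq W]
    {A : ι → Finset W} (hA : RadoCondition F A) {i : ι} {x y : W} (hxy : x ≠ y) :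
    RadoCondition F (Function.update A i ((A i).erase x)) ∨
      RadoCondition F (Function.update A i ((A i).erase y)) := by
  have mem_of_fails {z : W} {J : Finset ι}
      (hJ : Set.finrank F (⋃ j ∈ J, (Function.update A i ((A i).erase z) j : Set W)) < #J) :
      i ∈ J := by
    by_contra hi
    refine hJ.not_ge ((hA J).trans (Set.finrank_mono (Set.iUnion₂_mono fun j hj => ?_)))
    rw [Function.update_of_ne (ne_of_mem_of_not_mem hj hi)]
  by_contra! h
  simp only [RadoCondition, not_forall, not_le] at h
  obtain ⟨⟨J₁, h₁⟩, J₂, h₂⟩ := h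
  set s := ⋃ j ∈ J₁, (Function.update A i ((A i).erase x) j : Set W) with hs
  set t := ⋃ j ∈ J₂, (Function.update A i ((A i).erase y) j : Set W) with ht
  have hunion : ⋃ j ∈ J₁ ∪ J₂, (A j : Set W) ⊆ s ∪ t := by
    have := mem_of_fails h₁
    have := mem_of_fails h₂
    intro w
    simp only [hs, ht, Set.mem_union, Set.mem_iUnion, Function.update_apply]
    grind
  have hinter : ⋃ j ∈ (J₁ ∩ J₂).erase i, (A j : Set W) ⊆ s ∩ t := by
    intro w
    simp only [hs, ht, Set.mem_inter_iff, Set.mem_iUnion, Function.update_apply]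
    grind
  have hsubmod := finrank_union_add_finrank_inter_le (F := F) s t
  have hle_union := (hA _).trans (Set.finrank_mono hunion)
  have hle_inter := (hA _).trans (Set.finrank_mono hinter)
  have := card_union_add_card_inter J₁ J₂
  have := card_erase_add_one (mem_inter.2 ⟨mem_of_fails h₁, mem_of_fails h₂⟩)
  omega

/-- Rado's theorem. Of two elements of the same set one can always be removed, so a minimal family
satisfying the condition consists of singletons. -/
theorem RadoCondition.exists_linearIndependent [Finite ι] {A : ι → Finset W}
    (hA : RadoCondition F A) : ∃ x : ι → W, (∀ i, x i ∈ A i) ∧ LinearIndependent F x := by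
  classical
  have := Fintype.ofFinite ι
  obtain ⟨B, hBA, hB, hmin⟩ := exists_minimal_le_of_wellFoundedLT (RadoCondition F) A hA
  have eq_of_mem {i : ι} {x y : W} (hx : x ∈ B i) (hy : y ∈ B i) : x = y := by
    by_contra hxy
    rcases hB.update_erase_or_update_erase (i := i) hxy with h | h
    · simpa using hmin h (update_le_self_iff.2 (erase_subset _ _)) i hx
    · simpa using hmin h (update_le_self_iff.2 (erase_subset _ _)) i hy
  have hne (i : ι) : (B i).Nonempty := by
    by_contra! h
    simpa [h, Set.finrank] using hB {i}
  choose x hx using hne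
  have hunion : ⋃ i ∈ (univ : Finset ι), (B i : Set W) = Set.range x := by
    ext w
    simp only [Finset.mem_univ, Set.iUnion_true, Set.mem_iUnion, Finset.mem_coe, Set.mem_range]
    exact ⟨fun ⟨i, hi⟩ => ⟨i, eq_of_mem (hx i) hi⟩, fun ⟨i, hi⟩ => ⟨i, hi ▸ hx i⟩⟩
  refine ⟨x, fun i => hBA i (hx i), linearIndependent_iff_card_le_finrank_span.2 ?_⟩
  simpa only [hunion, card_univ] using hB univ

end Rado

section Edmonds

variable {F W ι : Type*} [Field F] [AddCommGroup W] [Module F W] [FiniteDimensional F W]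

theorem radoCondition_image_single [DecidableEq W] {v : ι → W} {d : ℕ} {B : Finset ι}
    (hB : ∀ J ⊆ B, #J ≤ d * Set.finrank F (v '' J)) :
    RadoCondition F fun i : B =>
      univ.image fun m : Fin d => Pi.single (M := fun _ => W) m (v i) := by
  intro J
  obtain ⟨C, hCJ, hC, hspan⟩ :=
    exists_linearIndepOn_span_image_eq (F := F) v (J.map (Function.Embedding.subtype _))
  have hsingle := Pi.linearIndependent_single (R := F) (fun (_ : Fin d) (i : C) => v i) fun _ => hC
  calc #J = #(J.map (Function.Embedding.subtype _)) := (card_map _).symm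
    _ ≤ d * Set.finrank F (v '' J.map (Function.Embedding.subtype _)) :=
        hB _ fun i hi => property_of_mem_map_subtype J hi
    _ = d * #C := by
        rw [← finrank_image_eq_card hC, Set.finrank, Set.finrank, hspan]
    _ = Fintype.card (Σ _ : Fin d, C) := by simp
    _ = Set.finrank F (Set.range fun p : Σ _ : Fin d, C =>
          Pi.single (M := fun _ => W) p.1 (v p.2)) := (finrank_span_eq_card hsingle).symm
    _ ≤ _ := Set.finrank_mono ?_
  rintro _ ⟨⟨m, i⟩, rfl⟩
  obtain ⟨j, hj, hji⟩ := mem_map.1 (hCJ i.2)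
  simp only [coe_image, Set.mem_iUnion]
  exact ⟨j, hj, m, mem_coe.2 (mem_univ m), by rw [← hji]; rfl⟩

/-- Edmonds' matroid covering theorem for vectors: replace `v i` by its `d` copies in `Fin d → W`
and choose independent representatives; the position of the chosen copy is the color of `i`. -/
theorem exists_linearIndepOn_cover {v : ι → W} {d : ℕ} {B : Finset ι}
    (hB : ∀ J ⊆ B, #J ≤ d * Set.finrank F (v '' J)) :
    ∃ C : Fin d → Set ι, (∀ m, LinearIndepOn F v (C m)) ∧ (B : Set ι) ⊆ ⋃ m, C m := by
  classical
  obtain ⟨x, hx, hind⟩ := (radoCondition_image_single hB).exists_linearIndependent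
  simp only [mem_image, mem_univ, true_and] at hx
  choose color hcolor using hx
  refine ⟨fun m => (↑) '' {i : B | color i = m}, fun m => ?_, fun i hi =>
    Set.mem_iUnion.2 ⟨color ⟨i, hi⟩, ⟨i, hi⟩, rfl, rfl⟩⟩
  have hx_eq : Set.EqOn x (LinearMap.single F (fun _ : Fin d => W) m ∘ v ∘ (↑))
      {i : B | color i = m} := by
    rintro i rfl
    exact (hcolor i).symm
  exact (((hind.linearIndepOn _).congr hx_eq).of_comp _).image_of_comp _ _

end Edmonds

section Covering

variable {F W : Type*} [Field F] [AddCommGroup W] [Module F W]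

variable (F) in
/-- The set `A` is contained in a union of `d` subspaces, none of which contains `x`. For the stored
vectors of a set of workers and an input `x`, this prevents the workers from determining the value
of a function of degree `d` at `x`. -/
def CoveredAvoiding (d : ℕ) (x : W) (A : Set W) : Prop :=
  ∃ C : Fin d → Submodule F W, (∀ m, x ∉ C m) ∧ A ⊆ ⋃ m, (C m : Set W)

theorem CoveredAvoiding.union_subspace {d : ℕ} {x : W} {A : Set W} (h : CoveredAvoiding F d x A)
    {p : Submodule F W} (hx : x ∉ p) : CoveredAvoiding F (d + 1) x (A ∪ p) := by
  obtain ⟨C, hC, hA⟩ := h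
  refine ⟨Fin.cons p C, Fin.cases hx hC, Set.union_subset (fun a ha => ?_) fun a ha =>
    Set.mem_iUnion.2 ⟨0, ha⟩⟩
  obtain ⟨m, hm⟩ := Set.mem_iUnion.1 (hA ha)
  exact Set.mem_iUnion.2 ⟨m.succ, hm⟩

theorem CoveredAvoiding.mono {d : ℕ} {x : W} {A B : Set W} (h : CoveredAvoiding F d x B)
    (hAB : A ⊆ B) : CoveredAvoiding F d x A :=
  let ⟨C, hC, hB⟩ := h
  ⟨C, hC, hAB.trans hB⟩

theorem CoveredAvoiding.of_le {d d' : ℕ} {x : W} {A : Set W} (h : CoveredAvoiding F d x A)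
    (hx : x ≠ 0) (hd : d ≤ d') : CoveredAvoiding F d' x A := by
  induction d', hd using Nat.le_induction with
  | base => exact h
  | succ d' _ ih =>
    exact (ih.union_subspace (p := ⊥) (by simpa using hx)).mono Set.subset_union_left

theorem CoveredAvoiding.exists_dual {d : ℕ} {x : W} {A : Set W} (h : CoveredAvoiding F d x A) :
    ∃ φ : Fin d → Dual F W, (∀ m, φ m x = 1) ∧ ∀ a ∈ A, ∃ m, φ m a = 0 := by
  obtain ⟨C, hC, hA⟩ := h
  choose ψ hψx hψ using fun m => exists_le_ker_of_notMem (hC m)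
  refine ⟨fun m => (ψ m x)⁻¹ • ψ m, fun m => inv_mul_cancel₀ (hψx m), fun a ha => ?_⟩
  obtain ⟨m, hm⟩ := Set.mem_iUnion.1 (hA ha)
  exact ⟨m, by simp [LinearMap.mem_ker.1 (hψ m hm)]⟩

end Covering

section GreedyCovering

variable {F W ι : Type*} [Field F] [AddCommGroup W] [Module F W]

theorem exists_card_le_one_notMem_span_image_sdiff [DecidableEq ι] {v : ι → W} {B : Finset ι}
    (hB : LinearIndepOn F v (B : Set ι)) {x : W} (hx : x ≠ 0) :
    ∃ D : Finset ι, #D ≤ 1 ∧ x ∉ span F (v '' ↑(B \ D)) := by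
  by_cases hxB : x ∈ span F (v '' B)
  · obtain ⟨l, hl, rfl⟩ := (Finsupp.mem_span_image_iff_linearCombination F).1 hxB
    obtain ⟨i, hi⟩ := Finsupp.ne_iff.1 (show l ≠ 0 by rintro rfl; simp at hx)
    refine ⟨{i}, by simp, fun hmem => hi ?_⟩
    obtain ⟨l', hl', heq⟩ := (Finsupp.mem_span_image_iff_linearCombination F).1 hmem
    have hl'B : l' ∈ Finsupp.supported F F (B : Set ι) :=
      Finsupp.supported_mono (by simp) hl'
    rw [← linearIndepOn_iffₛ.1 hB l' hl'B l hl heq]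
    exact (Finsupp.mem_supported' F l').1 hl' i (by simp)
  · exact ⟨∅, by simp, by simpa using hxB⟩

variable [FiniteDimensional F W]

/-- The subspaces are spanned by successive bases of what is left of `s`. -/
theorem exists_finrank_le_and_coveredAvoiding [DecidableEq ι] (v : ι → W) (d : ℕ) (s : Finset ι) :
    ∃ L ⊆ s, (d + 1) * Set.finrank F (v '' L) ≤ #s ∧ ∀ x ≠ 0, ∃ D : Finset ι, #D ≤ d ∧
      CoveredAvoiding F d x (v '' ↑(s \ (L ∪ D))) := by
  induction d generalizing s with
  | zero =>
    obtain ⟨B, hBs, hB, hspan⟩ := exists_linearIndepOn_span_image_eq (F := F) v s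
    refine ⟨s, Subset.rfl, ?_, fun x _ => ⟨∅, by simp, Fin.elim0, fun m => m.elim0, by simp⟩⟩
    rw [zero_add, one_mul, Set.finrank, ← hspan]
    exact (finrank_image_eq_card hB).trans_le (card_le_card hBs)
  | succ d ih =>
    obtain ⟨B, hBs, hB, hspan⟩ := exists_linearIndepOn_span_image_eq (F := F) v s
    obtain ⟨L, hL, hrank, hcover⟩ := ih (s \ B)
    have hLB : Set.finrank F (v '' L) ≤ #B := by
      rw [← finrank_image_eq_card hB, Set.finrank, Set.finrank, hspan]
      exact Set.finrank_mono (Set.image_mono (coe_subset.2 (hL.trans sdiff_subset)))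
    refine ⟨L, hL.trans sdiff_subset, ?_, fun x hx => ?_⟩
    · have := card_sdiff_add_card_eq_card hBs
      linarith
    · obtain ⟨D, hD, hcov⟩ := hcover x hx
      obtain ⟨D', hD', hxD'⟩ := exists_card_le_one_notMem_span_image_sdiff hB hx
      refine ⟨D ∪ D', (card_union_le D D').trans (add_le_add hD hD'),
        (hcov.union_subspace hxD').mono ?_⟩
      rintro _ ⟨i, hi, rfl⟩
      simp only [mem_coe, mem_sdiff, mem_union] at hi
      by_cases hiB : i ∈ B
      · exact Or.inr (subset_span ⟨i, mem_coe.2 (mem_sdiff.2 ⟨hiB, by tauto⟩), rfl⟩)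
      · exact Or.inl ⟨i, mem_coe.2 (by grind), rfl⟩

theorem exists_coveredAvoiding_of_card_lt {κ : Type*} [Fintype κ] {e : κ → W}
    (he : LinearIndependent F e) (v : ι → W) {d : ℕ} {s : Finset ι}
    (hs : #s < (d + 1) * Fintype.card κ) :
    ∃ j, ∃ R ⊆ s, #s ≤ #R + d ∧ CoveredAvoiding F (d + 1) (e j) (v '' R) := by
  classical
  obtain ⟨L, -, hL, hcover⟩ := exists_finrank_le_and_coveredAvoiding (F := F) v d s
  obtain ⟨j, hj⟩ : ∃ j, e j ∉ span F (v '' L) := by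
    by_contra! h
    have hrank : Fintype.card κ ≤ Set.finrank F (v '' L) :=
      (finrank_span_eq_card he).symm.trans_le (finrank_mono (span_le.2 (Set.range_subset_iff.2 h)))
    exact hs.not_ge ((Nat.mul_le_mul_left _ hrank).trans hL)
  obtain ⟨D, hD, hcov⟩ := hcover (e j) (he.ne_zero j)
  refine ⟨j, s \ D, sdiff_subset, ?_, (hcov.union_subspace hj).mono ?_⟩
  · have := le_card_sdiff D s
    omega
  · rintro _ ⟨i, hi, rfl⟩
    by_cases hiL : i ∈ L
    · exact Or.inr (subset_span ⟨i, hiL, rfl⟩)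
    · exact Or.inl ⟨i, by simp_all, rfl⟩

end GreedyCovering

section SparseCovering

variable {F W ι : Type*} [Field F] [AddCommGroup W] [Module F W]

variable (F) in
/-- Every nonempty `I ⊆ B` has at most `d * rank I - (d - 1)` elements, where the rank is that of
the vectors `v i`. Such a `B` can be covered by `d` independent sets even after passing to the
quotient by a vector outside the spans of its tight subsets. -/
def IsSparse (v : ι → W) (d : ℕ) (B : Finset ι) : Prop :=
  ∀ I ⊆ B, I.Nonempty → #I + d ≤ d * Set.finrank F (v '' I) + 1

variable (F) in
/-- The nonempty sets for which the inequality of `IsSparse` is an equality. Adding a vector to the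
span of such a set destroys sparsity, and intersecting tight subsets of a sparse set have a tight
union. -/
def IsTight (v : ι → W) (d : ℕ) (I : Finset ι) : Prop :=
  I.Nonempty ∧ #I + d = d * Set.finrank F (v '' I) + 1

variable [FiniteDimensional F W]

section Sparse

variable {v : ι → W} {d : ℕ} {B I J : Finset ι}

theorem IsTight.union [DecidableEq ι] (hB : IsSparse F v d B) (hI : IsTight F v d I)
    (hJ : IsTight F v d J) (hIB : I ⊆ B) (hJB : J ⊆ B) (hIJ : (I ∩ J).Nonempty) :
    IsTight F v d (I ∪ J) := by
  have hsubmod : Set.finrank F (v '' ↑(I ∪ J)) + Set.finrank F (v '' ↑(I ∩ J)) ≤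
      Set.finrank F (v '' I) + Set.finrank F (v '' J) := by
    rw [coe_union, coe_inter, Set.image_union]
    exact (add_le_add_right (Set.finrank_mono (Set.image_inter_subset v I J)) _).trans
      (finrank_union_add_finrank_inter_le _ _)
  have hunion := hB (I ∪ J) (union_subset hIB hJB) (hI.1.mono subset_union_left)
  have hinter := hB (I ∩ J) (inter_subset_left.trans hIB) hIJ
  have hcard := card_union_add_card_inter I J
  refine ⟨hI.1.mono subset_union_left, ?_⟩
  linarith [hI.2, hJ.2, Nat.mul_le_mul_left d hsubmod]

theorem IsSparse.exists_mem_span_of_not_insert [DecidableEq ι] (hd : 0 < d)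
    (hB : IsSparse F v d B) {i : ι} (hi : ¬IsSparse F v d (insert i B)) :
    ∃ I ⊆ B, d * Set.finrank F (v '' I) < #I + d ∧ v i ∈ span F (v '' I) := by
  simp only [IsSparse, not_forall, not_le] at hi
  obtain ⟨I, hI, hne, hlt⟩ := hi
  have hiI : i ∈ I := by
    by_contra h
    exact (hB I ((subset_insert_iff_of_notMem h).1 hI) hne).not_gt hlt
  have hIB : I.erase i ⊆ B := subset_insert_iff.1 hI
  have hcard := card_erase_add_one hiI
  have hsub : v '' ↑(I.erase i) ⊆ v '' I := Set.image_mono (coe_subset.2 (erase_subset i I))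
  have hrank : d * Set.finrank F (v '' ↑(I.erase i)) ≤ d * Set.finrank F (v '' I) :=
    Nat.mul_le_mul_left d (Set.finrank_mono hsub)
  refine ⟨I.erase i, hIB, by omega, ?_⟩
  have hle : d * Set.finrank F (v '' I) ≤ d * Set.finrank F (v '' ↑(I.erase i)) := by
    rcases (I.erase i).eq_empty_or_nonempty with h | h
    · rw [h, card_empty] at hcard
      have : d * Set.finrank F (v '' I) < d * 1 := by omega
      simp [Nat.lt_one_iff.1 (lt_of_mul_lt_mul_left' this)]
    · have := hB _ hIB h
      omega
  rw [eq_of_le_of_finrank_le (span_mono hsub) (le_of_mul_le_mul_left hle hd)]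
  exact subset_span ⟨i, hiI, rfl⟩

theorem exists_span_image_le_of_subset_iUnion (hI : d * Set.finrank F (v '' I) < #I + d)
    {C : Fin d → Set ι} (hC : ∀ m, LinearIndepOn F v (C m)) (hIC : (I : Set ι) ⊆ ⋃ m, C m) :
    ∃ m, span F (v '' I) ≤ span F (v '' C m) := by
  classical
  obtain ⟨m, hm⟩ : ∃ m, Set.finrank F (v '' I) ≤ #{i ∈ I | i ∈ C m} := by
    by_contra! h
    have hcover : I ⊆ univ.biUnion fun m => {i ∈ I | i ∈ C m} := fun i hi => by
      simpa [hi] using hIC hi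
    have : #I + d ≤ d * Set.finrank F (v '' I) :=
      calc #I + d ≤ (∑ m, #{i ∈ I | i ∈ C m}) + d := by
            gcongr; exact (card_le_card hcover).trans card_biUnion_le
        _ = ∑ m, (#{i ∈ I | i ∈ C m} + 1) := by simp [sum_add_distrib]
        _ ≤ ∑ _m : Fin d, Set.finrank F (v '' I) := sum_le_sum fun m _ => h m
        _ = d * Set.finrank F (v '' I) := by simp
    exact this.not_gt hI
  have hsub : v '' ↑{i ∈ I | i ∈ C m} ⊆ v '' I := Set.image_mono (coe_subset.2 (filter_subset _ I))
  have hsubC : (↑{i ∈ I | i ∈ C m} : Set ι) ⊆ C m := fun i hi => (mem_filter.1 hi).2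
  rw [← finrank_image_eq_card ((hC m).mono hsubC)] at hm
  refine ⟨m, (eq_of_le_of_finrank_le (span_mono hsub) hm).ge.trans ?_⟩
  exact span_mono (Set.image_mono hsubC)

end Sparse

section Quotient

theorem finrank_map_mkQ_add_finrank_inf (p q : Submodule F W) :
    finrank F (q.map p.mkQ) + finrank F (p ⊓ q : Submodule F W) = finrank F q := by
  rw [← (p.mkQ.domRestrict q).finrank_range_add_finrank_ker, LinearMap.range_domRestrict,
    LinearMap.ker_domRestrict, ker_mkQ, inf_comm, ← map_comap_subtype, finrank_map_subtype_eq]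

theorem finrank_le_finrank_image_mkQ_span_singleton_add_one (e : W) (s : Set W) :
    Set.finrank F s ≤ Set.finrank F ((span F {e}).mkQ '' s) + 1 := by
  have := finrank_map_mkQ_add_finrank_inf (span F {e}) (span F s)
  rw [Set.finrank, Set.finrank, span_image, ← this]
  gcongr
  exact (finrank_mono inf_le_left).trans ((finrank_span_le_card {e}).trans (by simp))

theorem finrank_image_mkQ_span_singleton {e : W} {s : Set W} (he : e ∉ span F s) :
    Set.finrank F ((span F {e}).mkQ '' s) = Set.finrank F s := by
  have := finrank_map_mkQ_add_finrank_inf (span F {e}) (span F s)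
  rw [(disjoint_span_singleton_of_notMem he).symm.eq_bot, finrank_bot] at this
  rw [Set.finrank, Set.finrank, span_image, ← this, add_zero]

end Quotient

section Cover

variable {v : ι → W} {d : ℕ} {B : Finset ι}

/-- Edmonds' theorem in the quotient by `e`. -/
theorem IsSparse.exists_linearIndepOn_cover_notMem (hd : 0 < d) (hB : IsSparse F v d B) {e : W}
    (he : e ≠ 0) (heB : ∀ I ⊆ B, IsTight F v d I → e ∉ span F (v '' I)) :
    ∃ C : Fin d → Set ι, (∀ m, LinearIndepOn F v (C m)) ∧ (∀ m, e ∉ span F (v '' C m)) ∧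
      (B : Set ι) ⊆ ⋃ m, C m := by
  have hrank (I : Finset ι) (hI : I ⊆ B) :
      #I ≤ d * Set.finrank F (((span F {e}).mkQ ∘ v) '' I) := by
    rcases I.eq_empty_or_nonempty with rfl | hne
    · simp
    have hle := hB I hI hne
    rw [Set.image_comp]
    by_cases heI : e ∈ span F (v '' I)
    · have hlt : #I + d ≠ d * Set.finrank F (v '' I) + 1 := fun h => heB I hI ⟨hne, h⟩ heI
      have := Nat.mul_le_mul_left d
        (finrank_le_finrank_image_mkQ_span_singleton_add_one (F := F) e (v '' I))
      rw [mul_add_one] at this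
      omega
    · rw [finrank_image_mkQ_span_singleton heI]
      omega
  obtain ⟨C, hC, hBC⟩ := exists_linearIndepOn_cover hrank
  refine ⟨C, fun m => (hC m).of_comp _, fun m hm => he ?_, hBC⟩
  have hdisj := range_ker_disjoint (hC m)
  rw [ker_mkQ, ← Set.image_eq_range] at hdisj
  exact disjoint_def.1 hdisj e hm (mem_span_singleton_self e)

theorem exists_coveredAvoiding_of_isSparse_maximal (hd : 0 < d) {s : Finset ι}
    (hB : Maximal (fun B => B ⊆ s ∧ IsSparse F v d B) B) {e : W} (he : e ≠ 0)
    (heB : ∀ I ⊆ B, IsTight F v d I → e ∉ span F (v '' I)) :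
    CoveredAvoiding F d e (v '' s) := by
  classical
  obtain ⟨C, hC, heC, hBC⟩ := hB.prop.2.exists_linearIndepOn_cover_notMem hd he heB
  refine ⟨fun m => span F (v '' C m), heC, ?_⟩
  rintro _ ⟨i, hi, rfl⟩
  rw [Set.mem_iUnion]
  by_cases hiB : i ∈ B
  · obtain ⟨m, hm⟩ := Set.mem_iUnion.1 (hBC hiB)
    exact ⟨m, subset_span ⟨i, hm, rfl⟩⟩
  · have hins : ¬IsSparse F v d (insert i B) := fun h =>
      hiB (hB.le_of_ge ⟨insert_subset hi hB.prop.1, h⟩ (subset_insert i B) (mem_insert_self i B))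
    obtain ⟨I, hIB, hI, hiI⟩ := hB.prop.2.exists_mem_span_of_not_insert hd hins
    obtain ⟨m, hm⟩ := exists_span_image_le_of_subset_iUnion hI hC ((coe_subset.2 hIB).trans hBC)
    exact ⟨m, hm hiI⟩

end Cover

section Counting

variable {κ : Type*} {v : ι → W} {d T : ℕ} {B : Finset ι} {e : κ → W}

theorem exists_pairwise_isTight (hB : IsSparse F v d B)
    (h : ∀ j, ∃ I ⊆ B, IsTight F v d I ∧ e j ∈ span F (v '' I)) :
    ∃ P : κ → Finset ι, (∀ j, P j ⊆ B ∧ IsTight F v d (P j) ∧ e j ∈ span F (v '' P j)) ∧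
      ∀ j k, P j ≠ P k → Disjoint (P j) (P k) := by
  classical
  choose I hIB hI heI using h
  choose P hIP hP using fun j => {I ∈ B.powerset | IsTight F v d I}.exists_le_maximal
    (mem_filter.2 ⟨mem_powerset.2 (hIB j), hI j⟩)
  have hPB (j : κ) : P j ⊆ B ∧ IsTight F v d (P j) := by
    simpa only [mem_filter, mem_powerset] using (hP j).prop
  refine ⟨P, fun j => ⟨(hPB j).1, (hPB j).2, span_mono (Set.image_mono (hIP j)) (heI j)⟩,
    fun j k hne => ?_⟩
  by_contra hjk
  have hunion : P j ∪ P k ∈ {I ∈ B.powerset | IsTight F v d I} :=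
    mem_filter.2 ⟨mem_powerset.2 (union_subset (hPB j).1 (hPB k).1),
      (hPB j).2.union hB (hPB k).2 (hPB j).1 (hPB k).1 (not_disjoint_iff_nonempty_inter.1 hjk)⟩
  exact hne (((hP j).eq_of_le hunion subset_union_left).trans
    ((hP k).eq_of_le hunion subset_union_right).symm)

theorem card_add_lt_of_isTight [Fintype κ] [Nonempty κ] (hT : 0 < T) (hB : IsSparse F v d B)
    (hrank : ∀ (J : Finset κ) (I : Finset ι), J.Nonempty → (∀ j ∈ J, e j ∈ span F (v '' I)) →
      #J + T ≤ Set.finrank F (v '' I))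
    (h : ∀ j, ∃ I ⊆ B, IsTight F v d I ∧ e j ∈ span F (v '' I)) :
    d * (Fintype.card κ + T) < #B + d := by
  classical
  obtain ⟨P, hP, hdisj⟩ := exists_pairwise_isTight hB h
  set Q := univ.image P with hQ
  have hQB : ∑ I ∈ Q, #I ≤ #B := by
    rw [← card_biUnion (fun I hI I' hI' hne => ?_)]
    · exact card_le_card (biUnion_subset.2 (forall_mem_image.2 fun j _ => (hP j).1))
    · obtain ⟨j, -, rfl⟩ := mem_image.1 hI
      obtain ⟨k, -, rfl⟩ := mem_image.1 hI'
      exact hdisj j k hne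
  have hfiber (I : Finset ι) (hI : I ∈ Q) : d * (#{j | P j = I} + T) + 1 ≤ #I + d := by
    obtain ⟨j, -, rfl⟩ := mem_image.1 hI
    rw [(hP j).2.1.2]
    gcongr
    refine hrank _ _ ⟨j, by simp⟩ fun k hk => ?_
    rw [← (mem_filter.1 hk).2]
    exact (hP k).2.2
  have hcard : Fintype.card κ = ∑ I ∈ Q, #{j | P j = I} := card_eq_sum_card_image P univ
  have hsum := sum_le_sum hfiber
  simp only [sum_add_distrib, ← mul_sum, sum_const, smul_eq_mul, mul_one, ← hcard] at hsum
  obtain ⟨n, hn⟩ := Nat.exists_eq_add_one_of_ne_zero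
    (card_pos.2 (univ_nonempty.image P)).ne'
  rw [← hQ] at hn
  rw [hn] at hsum
  nlinarith [Nat.mul_le_mul_left (n * d) hT]

end Counting

section PrivateRank

variable {v : ι → W} {T : ℕ} {E : Submodule F W}

theorem finrank_add_le_finrank_image
    (hE : ∀ C : Finset ι, #C ≤ T → Disjoint (span F (v '' C)) E) {P : Submodule F W} (hPE : P ≤ E)
    (hP : P ≠ ⊥) {I : Finset ι} (hPI : P ≤ span F (v '' I)) :
    finrank F P + T ≤ Set.finrank F (v '' I) := by
  classical
  obtain ⟨C, -, hC, hspan⟩ := exists_linearIndepOn_span_image_eq (F := F) (P.mkQ ∘ v) I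
  have hcard : #C + finrank F P = Set.finrank F (v '' I) := by
    have := finrank_map_mkQ_add_finrank_inf P (span F (v '' I))
    rw [inf_eq_left.2 hPI, map_span, ← Set.image_comp, ← hspan] at this
    rw [← finrank_image_eq_card hC]
    exact this
  by_contra hlt
  have hCT : #C < T := by omega
  have hIC (i : ι) (hi : i ∈ I) : v i ∈ span F (v '' C) := by
    have hmem : P.mkQ (v i) ∈ map P.mkQ (span F (v '' C)) := by
      rw [map_span, ← Set.image_comp, hspan]
      exact subset_span ⟨i, hi, rfl⟩
    obtain ⟨y, hy, hyi⟩ := mem_map.1 hmem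
    have hsub : y - v i ∈ P := (Submodule.Quotient.eq P).1 hyi
    have hyC : y - v i ∈ span F (v '' ↑(insert i C)) := by
      rw [coe_insert, Set.image_insert_eq]
      exact sub_mem (span_mono (Set.subset_insert _ _) hy) (subset_span (Set.mem_insert _ _))
    have := disjoint_def.1 (hE _ ((card_insert_le i C).trans hCT)) _ hyC (hPE hsub)
    rwa [← sub_eq_zero.1 this]
  have hPC : P ≤ span F (v '' C) :=
    hPI.trans (span_le.2 (by rintro _ ⟨i, hi, rfl⟩; exact hIC i hi))
  exact hP (le_bot_iff.1 (hE C hCT.le hPC hPE))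

theorem exists_coveredAvoiding_of_card_add_le {κ : Type*} [Fintype κ] [Nonempty κ] {e : κ → W}
    (he : LinearIndependent F e) {d : ℕ} (hd : 0 < d) (hT : 0 < T)
    (hE : ∀ C : Finset ι, #C ≤ T → Disjoint (span F (v '' C)) (span F (Set.range e)))
    {s : Finset ι} (hs : #s + d ≤ d * (Fintype.card κ + T)) :
    ∃ j, CoveredAvoiding F d (e j) (v '' s) := by
  classical
  obtain ⟨B, hB⟩ := {B ∈ s.powerset | IsSparse F v d B}.exists_maximal
    ⟨∅, mem_filter.2 ⟨empty_mem_powerset s, fun I hI hne => by simp [subset_empty.1 hI] at hne⟩⟩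
  simp only [mem_filter, mem_powerset] at hB
  have hrank (J : Finset κ) (I : Finset ι) (hJ : J.Nonempty) (h : ∀ j ∈ J, e j ∈ span F (v '' I)) :
      #J + T ≤ Set.finrank F (v '' I) := by
    obtain ⟨j, hj⟩ := hJ
    rw [← finrank_image_eq_card (he.linearIndepOn (J : Set κ))]
    refine finrank_add_le_finrank_image hE (span_mono (Set.image_subset_range e J))
      ((Submodule.ne_bot_iff _).2 ⟨e j, subset_span ⟨j, hj, rfl⟩, he.ne_zero j⟩) (span_le.2 ?_)
    rintro _ ⟨k, hk, rfl⟩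
    exact h k hk
  obtain ⟨j, hj⟩ : ∃ j, ∀ I ⊆ B, IsTight F v d I → e j ∉ span F (v '' I) := by
    by_contra! h
    have := card_add_lt_of_isTight hT hB.prop.2 hrank h
    have := card_le_card hB.prop.1
    omega
  exact ⟨j, exists_coveredAvoiding_of_isSparse_maximal hd hB (he.ne_zero j) hj⟩

end PrivateRank
end SparseCovering

section MutualInfo

theorem mutualInfo_eq_zero_iff {Ω α β : Type*} [MeasurableSpace Ω] [MeasurableSpace α]
    [MeasurableSpace β] {P : Measure Ω} [IsFiniteMeasure P] {X : Ω → α} {Y : Ω → β}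
    (hX : Measurable X) (hY : Measurable Y) : mutualInfo P X Y = 0 ↔ IndepFun X Y P := by
  rw [indepFun_iff_map_prod_eq_prod_map_map hX.aemeasurable hY.aemeasurable, mutualInfo,
    InformationTheory.klDiv_eq_zero_iff]

theorem mutualInfo_uniformOn_univ_eq_zero_iff {Ω α β : Type*} [MeasurableSpace Ω]
    [MeasurableSpace α] [MeasurableSpace β] [DiscreteMeasurableSpace Ω] [DiscreteMeasurableSpace α]
    [DiscreteMeasurableSpace β] [Finite Ω] [Nonempty Ω] {X : Ω → α} {Y : Ω → β} :
    mutualInfo (uniformOn Set.univ) X Y = 0 ↔ ∀ s t,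
      (X ⁻¹' s ∩ Y ⁻¹' t).ncard * Nat.card Ω = (X ⁻¹' s).ncard * (Y ⁻¹' t).ncard := by
  have := Fintype.ofFinite Ω
  have hreal (s : Set Ω) : (uniformOn Set.univ).real s = (s.ncard : ℝ) / Nat.card Ω := by
    rw [measureReal_def, uniformOn_univ, Measure.count_apply .of_discrete,
      ← s.toFinite.cast_ncard_eq, Nat.card_eq_fintype_card, ENNReal.toReal_div,
      ENat.toENNReal_coe, ENNReal.toReal_natCast, ENNReal.toReal_natCast]
  have hcard : (Nat.card Ω : ℝ) ≠ 0 := mod_cast Nat.card_pos.ne'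
  rw [mutualInfo_eq_zero_iff .of_discrete .of_discrete,
    indepFun_iff_measure_inter_preimage_eq_mul]
  refine forall₂_congr fun s t => ?_
  simp only [MeasurableSet.of_discrete, true_imp_iff]
  rw [← ENNReal.toReal_eq_toReal_iff' (measure_ne_top _ _) (by finiteness), ENNReal.toReal_mul]
  simp only [← measureReal_def, hreal]
  rw [← Nat.cast_inj (R := ℝ)]
  push_cast
  field_simp

theorem mutualInfo_fst_eq_zero_of_perm {α β γ : Type*} [MeasurableSpace α] [MeasurableSpace β]
    [MeasurableSpace γ] [DiscreteMeasurableSpace α] [DiscreteMeasurableSpace β]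
    [DiscreteMeasurableSpace γ] [Finite α] [Finite β] [Nonempty α] [Nonempty β] {Y : α × β → γ}
    (e : α → Equiv.Perm β) (g : β → γ) (hY : ∀ x z, Y (x, e x z) = g z) :
    mutualInfo (uniformOn Set.univ) Prod.fst Y = 0 := by
  set θ : Equiv.Perm (α × β) := (Equiv.refl α).prodShear e
  have ncard_preimage (u : Set (α × β)) : (θ ⁻¹' u).ncard = u.ncard :=
    Set.ncard_preimage_of_injective_subset_range θ.injective (by simp)
  have hYθ : Y ∘ θ = g ∘ Prod.snd := funext fun p => hY p.1 p.2
  refine mutualInfo_uniformOn_univ_eq_zero_iff.2 fun s t => ?_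
  rw [← ncard_preimage (Prod.fst ⁻¹' s ∩ _), ← ncard_preimage (Y ⁻¹' t), Set.preimage_inter,
    ← Set.preimage_comp, ← Set.preimage_comp, hYθ]
  have hfst : Prod.fst ∘ θ = Prod.fst := rfl
  have hinter : Prod.fst ⁻¹' s ∩ g ∘ Prod.snd ⁻¹' t = s ×ˢ (g ⁻¹' t) := rfl
  have hs : Prod.fst ⁻¹' s = s ×ˢ (Set.univ : Set β) := Set.prod_univ.symm
  have ht : g ∘ Prod.snd ⁻¹' t = (Set.univ : Set α) ×ˢ (g ⁻¹' t) := by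
    rw [Set.univ_prod, Set.preimage_comp]
  rw [hfst, hinter, hs, ht, Set.ncard_prod, Set.ncard_prod, Set.ncard_prod, Nat.card_prod,
    Set.ncard_univ, Set.ncard_univ]
  ring

end MutualInfo

namespace LinearEncoder

variable {F : Type*} [Field F] {K N : ℕ} (E : LinearEncoder F K N) {V : Type*} [AddCommGroup V]
  [Module F V] {T : ℕ}

section CoefficientVectors

/-- The coefficients of the data stored at worker `i`, as a vector. -/
def workerVector (i : Fin N) : (Fin K → F) × (Fin E.numKeys → F) :=
  (E.dataCoeff i, E.keyCoeff i)

/-- The coefficient vector of the input `X j` itself. -/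
def dataVector (j : Fin K) : (Fin K → F) × (Fin E.numKeys → F) :=
  (Pi.single j 1, 0)

/-- The linear combination of inputs and keys with given coefficients. -/
noncomputable def combine (X : Fin K → V) (Z : Fin E.numKeys → V) :
    (Fin K → F) × (Fin E.numKeys → F) →ₗ[F] V :=
  (Fintype.linearCombination F X).coprod (Fintype.linearCombination F Z)

theorem combine_workerVector (X : Fin K → V) (Z : Fin E.numKeys → V) (i : Fin N) :
    E.combine X Z (E.workerVector i) = E.encode X Z i := rfl

theorem linearIndependent_dataVector : LinearIndependent F E.dataVector :=
  .of_comp (LinearMap.fst F _ _) (Pi.linearIndependent_single_one (Fin K) F)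

theorem snd_eq_zero_of_mem_span_dataVector {x : (Fin K → F) × (Fin E.numKeys → F)}
    (hx : x ∈ span F (Set.range E.dataVector)) : x.2 = 0 := by
  have hle : span F (Set.range E.dataVector) ≤ LinearMap.ker (LinearMap.snd F (Fin K → F) _) :=
    span_le.2 (Set.range_subset_iff.2 fun _ => rfl)
  exact hle hx

theorem exists_encode_eq (φ : (Fin K → F) × (Fin E.numKeys → F) →ₗ[F] V) :
    ∃ Z, ∀ i, E.encode (fun k => φ (E.dataVector k)) Z i = φ (E.workerVector i) := by
  refine ⟨fun l => φ (0, Pi.single l 1), fun i => ?_⟩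
  rw [← combine_workerVector]
  congr 1
  ext <;> simp [combine, dataVector, Fintype.linearCombination_apply, Pi.single_apply]

end CoefficientVectors

section Privacy

/-- `uniformOn` an infinite set is the zero measure. -/
theorem isPrivate_of_infinite (hK : 0 < K) [Infinite V] : E.IsPrivate V T := by
  intro C _
  let _ : MeasurableSpace V := ⊤
  have : Nonempty (Fin K) := ⟨⟨0, hK⟩⟩
  have hzero : uniformOn (Set.univ : Set ((Fin K → V) × (Fin E.numKeys → V))) = 0 :=
    (uniformOn_eq_zero' MeasurableSet.univ).2 (Or.inl Set.infinite_univ)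
  simp [mutualInfo, hzero]

theorem isPrivate_of_exists_key_shift [Finite V]
    (h : ∀ C : Finset (Fin N), #C ≤ T → ∃ z : Fin K → Fin E.numKeys → F,
      ∀ i ∈ C, ∀ j, E.dataCoeff i j + ∑ l, E.keyCoeff i l * z j l = 0) : E.IsPrivate V T := by
  intro C hC
  obtain ⟨z, hz⟩ := h C hC
  let _ : MeasurableSpace V := ⊤
  have : DiscreteMeasurableSpace V := ⟨fun _ => trivial⟩
  refine mutualInfo_fst_eq_zero_of_perm
    (fun X => Equiv.addLeft fun l => ∑ j, z j l • X j) (fun Z i => E.encode 0 Z i) fun X Z => ?_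
  funext i
  have hcancel : E.encode X (fun l => ∑ j, z j l • X j) i = 0 := by
    have hswap : ∑ l, E.keyCoeff i l • ∑ j, z j l • X j =
        ∑ j, (∑ l, E.keyCoeff i l * z j l) • X j := by
      simp only [smul_sum, smul_smul, sum_smul]
      exact sum_comm
    rw [encode, hswap, ← sum_add_distrib]
    simp only [← add_smul, hz i i.2, zero_smul, sum_const_zero]
  calc E.encode X ((fun l => ∑ j, z j l • X j) + Z) i
      = E.encode X (fun l => ∑ j, z j l • X j) i + E.encode 0 Z i := by
        simp [encode, sum_add_distrib, add_assoc]
    _ = E.encode 0 Z i := by rw [hcancel, zero_add]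

theorem isPrivate_zero (hK : 0 < K) : E.IsPrivate V 0 := by
  rcases finite_or_infinite V with hV | hV
  · refine E.isPrivate_of_exists_key_shift fun C hC => ⟨0, fun i hi => ?_⟩
    simp [card_eq_zero.1 (Nat.le_zero.1 hC)] at hi
  · exact E.isPrivate_of_infinite hK

variable {E} in
theorem IsPrivate.disjoint_span [Finite V] [Nontrivial V] (hE : E.IsPrivate V T)
    {C : Finset (Fin N)} (hC : #C ≤ T) :
    Disjoint (span F (E.workerVector '' C)) (span F (Set.range E.dataVector)) := by
  refine disjoint_def.2 fun x hx hx' => ?_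
  have hx₂ := E.snd_eq_zero_of_mem_span_dataVector hx'
  obtain ⟨a, rfl⟩ := (mem_span_image_finset_iff_exists_fun' F).1 hx
  set x := ∑ i ∈ C, a i • E.workerVector i
  by_contra hx0
  obtain ⟨j, hj⟩ : ∃ j, x.1 j ≠ 0 := Function.ne_iff.1 fun h => hx0 (Prod.ext h hx₂)
  obtain ⟨v, hv⟩ := exists_ne (0 : V)
  have hcombine (X : Fin K → V) (Z : Fin E.numKeys → V) :
      ∑ i : C, a i • E.encode X Z i = Fintype.linearCombination F X x.1 := by
    calc ∑ i : C, a i • E.encode X Z i = ∑ i ∈ C, a i • E.combine X Z (E.workerVector i) :=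
          sum_coe_sort C fun i => a i • E.encode X Z i
      _ = E.combine X Z x := by simp only [x, map_sum, map_smul]
      _ = Fintype.linearCombination F X x.1 := by simp [combine, hx₂]
  let _ : MeasurableSpace V := ⊤
  have : DiscreteMeasurableSpace V := ⟨fun _ => trivial⟩
  have h := mutualInfo_uniformOn_univ_eq_zero_iff.1 (hE C hC)
    {X | Fintype.linearCombination F X x.1 ≠ 0} {y | ∑ i : C, a i • y i = 0}
  have hdata : (Pi.single j v, 0) ∈ Prod.fst (β := Fin E.numKeys → V) ⁻¹'
      {X | Fintype.linearCombination F X x.1 ≠ 0} := by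
    simp [Fintype.linearCombination_apply, Pi.single_apply, hj, hv]
  have hstored : 0 ∈ (fun (ω : (Fin K → V) × (Fin E.numKeys → V)) (i : C) =>
      E.encode ω.1 ω.2 i) ⁻¹' {y | ∑ i : C, a i • y i = 0} :=
    (hcombine 0 0).trans (by simp [Fintype.linearCombination_apply])
  have hne := mul_ne_zero (Set.ncard_ne_zero_of_mem hdata) (Set.ncard_ne_zero_of_mem hstored)
  rw [← h] at hne
  obtain ⟨ω, hω, hω'⟩ := Set.nonempty_of_ncard_ne_zero (left_ne_zero_of_mul hne)
  exact hω ((hcombine ω.1 ω.2).symm.trans hω')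

end Privacy
end LinearEncoder

section Decoding

variable {F V U : Type*} [Field F] [AddCommGroup V] [Module F V] {K N S A T r : ℕ}

theorem exists_coveredAvoiding_of_not_inRegion {d : ℕ} {W : Type*} [AddCommGroup W] [Module F W]
    [FiniteDimensional F W] {e : Fin K → W} {v : Fin N → W} (he : LinearIndependent F e)
    (hK : 0 < K) (hd : 0 < d)
    (hE : ∀ C : Finset (Fin N), #C ≤ T → Disjoint (span F (v '' C)) (span F (Set.range e)))
    (h : ¬InRegion N K d S A T) :
    ∃ j, ∃ R : Finset (Fin N), N ≤ #R + (S + 2 * A) ∧ CoveredAvoiding F d (e j) (v '' R) := by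
  obtain ⟨K, rfl⟩ := Nat.exists_eq_add_one_of_ne_zero hK.ne'
  rw [InRegion] at h
  have exists_card_eq {n : ℕ} (hn : n ≤ N) : ∃ s : Finset (Fin N), #s = n := by
    simpa using exists_subset_card_eq (s := (univ : Finset (Fin N))) (by simpa using hn)
  rcases T.eq_zero_or_pos with rfl | hT
  · by_cases hKd : (K + 1) * d ≤ N + 1
    · rw [if_pos (.inr hKd)] at h
      obtain ⟨d, rfl⟩ := Nat.exists_eq_add_one_of_ne_zero hd.ne'
      obtain ⟨s, hs⟩ := exists_card_eq (n := (K + 1) * (d + 1) - 1) (Nat.sub_le_of_le_add hKd)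
      obtain ⟨j, R, -, hR, hcov⟩ := exists_coveredAvoiding_of_card_lt (d := d) (s := s) he v <| by
        rw [Fintype.card_fin, hs, mul_comm (d + 1)]
        exact Nat.sub_lt (by positivity) one_pos
      refine ⟨j, R, ?_, hcov⟩
      simp only [add_mul, add_zero, one_mul, Nat.add_sub_cancel] at h hs
      omega
    · rw [if_neg (by simpa using hKd)] at h
      have hr : N / (K + 1) ≤ S + 2 * A := Nat.lt_succ_iff.1 <| Nat.div_lt_of_lt_mul (not_le.1 h)
      have hdiv : N / (K + 1) + 1 ≤ d := Nat.succ_le_of_lt <| Nat.div_lt_of_lt_mul (by omega)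
      obtain ⟨j, R, -, hR, hcov⟩ :=
        exists_coveredAvoiding_of_card_lt (d := N / (K + 1)) (s := univ) he v <| by
          rw [card_fin, Fintype.card_fin, mul_comm]
          exact Nat.lt_mul_div_succ N hK
      rw [card_fin] at hR
      exact ⟨j, R, by omega, hcov.of_le (he.ne_zero j) hdiv⟩
  · rw [if_pos (.inl hT)] at h
    obtain ⟨s, hs⟩ := exists_card_eq (min_le_left N ((K + T) * d))
    obtain ⟨j, hcov⟩ := exists_coveredAvoiding_of_card_add_le (s := s) he hd hT hE <| by
      rw [Fintype.card_fin, hs, mul_comm d, show K + 1 + T = K + T + 1 by omega, add_one_mul]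
      exact Nat.add_le_add_right (min_le_right ..) d
    refine ⟨j, s, ?_, hcov⟩
    rw [show K + 1 + T - 1 = K + T by omega] at h
    omega

namespace LinearEncoder

/-- Any `N - r` uncorrupted results of the workers determine the values of `f` at the inputs. -/
def DeterminesOutputs (E : LinearEncoder F K N) (f : V → U) (r : ℕ) : Prop :=
  ∀ R : Finset (Fin N), N ≤ #R + r → ∀ X X' Z Z',
    (∀ i ∈ R, f (E.encode X Z i) = f (E.encode X' Z' i)) → ∀ k, f (X k) = f (X' k)

theorem Decodes.eq_of_agree {E : LinearEncoder F K N} {f : V → U} {Ω : Type*} [MeasurableSpace Ω]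
    {P : MeasureTheory.Measure Ω} [NeZero P] {h : Ω → Decoder K N U}
    (hdec : E.Decodes f S A P h) {R B B' : Finset (Fin N)} (hR : N ≤ #R + S)
    {X X' : Fin K → V} {Z Z' : Fin E.numKeys → V} (hB : #B ≤ A) (hB' : #B' ≤ A)
    (hagree : ∀ i ∈ R, i ∉ B → i ∉ B' → f (E.encode X Z i) = f (E.encode X' Z' i)) (k : Fin K) :
    f (X k) = f (X' k) := by
  classical
  let y : R → U := fun i => if i.1 ∈ B then f (E.encode X Z i) else f (E.encode X' Z' i)
  have ncard_le {Q : R → Prop} {C : Finset (Fin N)} (hC : #C ≤ A) (hQ : ∀ i, Q i → i.1 ∈ C) :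
      {i | Q i}.ncard ≤ A := by
    refine le_trans ?_ (hC.trans' (Set.ncard_coe_finset C).le)
    exact Set.ncard_le_ncard_of_injOn Subtype.val hQ Subtype.val_injective.injOn
  have hy : {i : R | y i ≠ f (E.encode X Z i)}.ncard ≤ A := by
    refine ncard_le hB' fun i hi => ?_
    by_contra hiB'
    by_cases hiB : i.1 ∈ B
    · exact hi (if_pos hiB)
    · exact hi ((if_neg hiB).trans (hagree i i.2 hiB hiB').symm)
  have hy' : {i : R | y i ≠ f (E.encode X' Z' i)}.ncard ≤ A :=
    ncard_le hB fun i hi => by_contra fun hiB => hi (if_neg hiB)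
  obtain ⟨ω, hω, hω'⟩ := ((hdec X Z R hR y hy).and (hdec X' Z' R hR y hy')).exists
  exact congrFun (hω.symm.trans hω') k

/- Where the results for two families of inputs differ at up to `2 * A` responding workers, half of
them can report the one result and half the other, which is consistent with both families. -/
theorem Decodes.determinesOutputs {E : LinearEncoder F K N} {f : V → U} {Ω : Type*}
    [MeasurableSpace Ω] {P : MeasureTheory.Measure Ω} [NeZero P] {h : Ω → Decoder K N U}
    (hdec : E.Decodes f S A P h) : E.DeterminesOutputs f (S + 2 * A) := by
  intro R hR X X' Z Z' hagree k
  classical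
  obtain ⟨R', hRR', -, hR'⟩ := exists_subsuperset_card_eq (n := min N (#R + 2 * A))
    (subset_univ R) (le_min (by simpa using card_le_univ R) (by omega)) (by simp)
  have hdiff : #(R' \ R) ≤ 2 * A := by
    rw [card_sdiff_of_subset hRR']
    omega
  obtain ⟨B, hBR', hB⟩ := exists_subset_card_eq (min_le_right A #(R' \ R))
  refine hdec.eq_of_agree (R := R') (B := B) (B' := (R' \ R) \ B) (Z := Z) (Z' := Z') (by omega)
    (by omega) ?_ ?_ k
  · rw [card_sdiff_of_subset hBR']
    omega
  · intro i hi hiB hiB'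
    refine hagree i (by_contra fun hiR => hiB' ?_)
    exact mem_sdiff.2 ⟨mem_sdiff.2 ⟨hi, hiR⟩, hiB⟩

theorem DeterminesOutputs.eq_of_ncard_le {E : LinearEncoder F K N} {f : V → U}
    (hE : E.DeterminesOutputs f (S + 2 * A)) {R : Finset (Fin N)} (hR : N ≤ #R + S) {y : R → U}
    {X X' : Fin K → V} {Z Z' : Fin E.numKeys → V}
    (hy : {i : R | y i ≠ f (E.encode X Z i)}.ncard ≤ A)
    (hy' : {i : R | y i ≠ f (E.encode X' Z' i)}.ncard ≤ A) (k : Fin K) : f (X k) = f (X' k) := by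
  classical
  let B : Finset R := {i | y i ≠ f (E.encode X Z i)}
  let B' : Finset R := {i | y i ≠ f (E.encode X' Z' i)}
  have hB : #B ≤ A := by rwa [← Set.ncard_coe_finset, coe_filter_univ]
  have hB' : #B' ≤ A := by rwa [← Set.ncard_coe_finset, coe_filter_univ]
  have hcard : #R ≤ #(B ∪ B')ᶜ + (#B + #B') := by
    rw [card_compl, Fintype.card_coe]
    have := card_union_le B B'
    omega
  refine hE ((B ∪ B')ᶜ.map (.subtype _)) (by rw [card_map]; omega) X X' Z Z' (fun i hi => ?_) k
  obtain ⟨i, hiB, rfl⟩ := mem_map.1 hi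
  simp only [B, B', mem_compl, mem_union, mem_filter_univ, not_or, not_not] at hiB
  exact hiB.1.symm.trans hiB.2

theorem achieves_of_decoder {E : LinearEncoder F K N} {D : Set (Decoder K N U)} {f : V → U}
    (hkeys : E.numKeys ≠ 0 → Finite V) (hE : E.IsPrivate V T) {h : Decoder K N U} (hD : h ∈ D)
    (hdec : ∀ (X : Fin K → V) (Z : Fin E.numKeys → V) (R : Finset (Fin N)), N ≤ #R + S →
      ∀ y : R → U, {i : R | y i ≠ f (E.encode X Z i)}.ncard ≤ A → h R y = fun k => f (X k)) :
    E.Achieves.{w} D f S A T :=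
  ⟨hkeys, hE, PUnit, ⊤, .dirac PUnit.unit, fun _ => h, inferInstance, fun _ => hD,
    fun X Z R hR y hy => .of_forall fun _ => hdec X Z R hR y hy⟩

theorem DeterminesOutputs.achieves {E : LinearEncoder F K N} {f : V → U}
    (hf : E.DeterminesOutputs f (S + 2 * A)) (hkeys : E.numKeys ≠ 0 → Finite V)
    (hE : E.IsPrivate V T) : E.Achieves.{w} Set.univ f S A T := by
  have hdec (R : Finset (Fin N)) (y : R → U) : ∃ x : Fin K → U, N ≤ #R + S → ∀ X Z,
      {i : R | y i ≠ f (E.encode X Z i)}.ncard ≤ A → x = fun k => f (X k) := by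
    by_cases hex : ∃ X Z, {i : R | y i ≠ f (E.encode X Z i)}.ncard ≤ A
    · obtain ⟨X, Z, hy⟩ := hex
      exact ⟨fun k => f (X k), fun hR X' Z' hy' => funext (hf.eq_of_ncard_le hR hy hy')⟩
    · exact ⟨fun _ => f 0, fun _ X Z hy => absurd ⟨X, Z, hy⟩ hex⟩
  choose h hh using hdec
  exact achieves_of_decoder hkeys hE (Set.mem_univ h) fun X Z R hR y => hh R y hR X Z

/-- Any `N - r` results of the workers give the values of `f` at the inputs as linear
combinations. -/
def HasLinearRecovery [AddCommGroup U] [Module F U] (E : LinearEncoder F K N) (f : V → U) (r : ℕ) :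
    Prop :=
  ∀ R : Finset (Fin N), N ≤ #R + r → ∃ c : Fin K → Fin N → F, ∀ X Z k,
    f (X k) = ∑ i ∈ R, c k i • f (E.encode X Z i)

theorem HasLinearRecovery.determinesOutputs [AddCommGroup U] [Module F U]
    {E : LinearEncoder F K N} {f : V → U} (hE : E.HasLinearRecovery f r) :
    E.DeterminesOutputs f r := by
  intro R hR X X' Z Z' hagree k
  obtain ⟨c, hc⟩ := hE R hR
  rw [hc X Z, hc X' Z']
  exact sum_congr rfl fun i hi => by rw [hagree i hi]

theorem HasLinearRecovery.achieves [AddCommGroup U] [Module F U] {E : LinearEncoder F K N}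
    {f : V → U} (hf : E.HasLinearRecovery f S) (hkeys : E.numKeys ≠ 0 → Finite V)
    (hE : E.IsPrivate V T) : E.Achieves.{w} (linearDecoders F K N U) f S 0 T := by
  have hcoeff (R : Finset (Fin N)) : ∃ c : Fin K → Fin N → F, N ≤ #R + S → ∀ X Z k,
      f (X k) = ∑ i ∈ R, c k i • f (E.encode X Z i) := by
    by_cases hR : N ≤ #R + S
    · obtain ⟨c, hc⟩ := hf R hR
      exact ⟨c, fun _ => hc⟩
    · exact ⟨0, fun h => absurd h hR⟩
  choose c hc using hcoeff
  refine achieves_of_decoder hkeys hE (h := fun R y k => ∑ i : R, c R k i • y i)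
    (fun R => ⟨fun k i => c R k i, fun _ _ => rfl⟩) fun X Z R hR y hy => ?_
  have hy₀ : {i : R | y i ≠ f (E.encode X Z i)} = ∅ :=
    (Set.ncard_eq_zero).1 (Nat.le_zero.1 hy)
  have hy_eq (i : R) : y i = f (E.encode X Z i) := by
    simpa using Set.eq_empty_iff_forall_notMem.1 hy₀ i
  funext k
  simp only [hy_eq, hc R hR X Z k]
  exact sum_coe_sort R fun i => c R k i • f (E.encode X Z i)

theorem Achieves.determinesOutputs {E : LinearEncoder F K N} {D : Set (Decoder K N U)}
    {f : V → U} (hE : E.Achieves.{w} D f S A T) :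
    E.DeterminesOutputs f (S + 2 * A) := by
  obtain ⟨-, -, Ω, _, P, h, _, -, hdec⟩ := hE
  exact hdec.determinesOutputs

theorem Achieves.exists_coveredAvoiding {E : LinearEncoder F K N} {D : Set (Decoder K N U)}
    {f : V → U} {d : ℕ} [Nontrivial V] (hE : E.Achieves.{w} D f S A T)
    (hK : 0 < K) (hd : 0 < d) (hT : 0 < T → Finite V) (h : ¬InRegion N K d S A T) :
    ∃ j, ∃ R : Finset (Fin N), N ≤ #R + (S + 2 * A) ∧
      CoveredAvoiding F d (E.dataVector j) (E.workerVector '' R) := by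
  refine exists_coveredAvoiding_of_not_inRegion E.linearIndependent_dataVector hK hd
    (fun C hC => ?_) h
  rcases T.eq_zero_or_pos with rfl | hT₀
  · simp [card_eq_zero.1 (Nat.le_zero.1 hC)]
  · have := hT hT₀
    exact hE.2.1.disjoint_span hC

end LinearEncoder

end Decoding

section FiniteDifference

open Polynomial

variable {R ι : Type*} [CommRing R]

theorem natDegree_taylor_sub_le (P : R[X]) (r : R) {n : ℕ} (hP : P.natDegree ≤ n + 1) :
    (taylor r P - P).natDegree ≤ n := by
  refine natDegree_le_iff_coeff_eq_zero.2 fun k hk => ?_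
  have hdeg : (hasseDeriv k P).natDegree < 1 :=
    (natDegree_hasseDeriv_le P k).trans_lt (by omega)
  simp [taylor_coeff, eval_eq_sum_range' hdeg, hasseDeriv_coeff]

theorem coeff_taylor_sub (P : R[X]) (r : R) {n : ℕ} (hP : P.natDegree ≤ n + 1) :
    (taylor r P - P).coeff n = (n + 1) * P.coeff (n + 1) * r := by
  have hdeg : (hasseDeriv n P).natDegree < 2 :=
    (natDegree_hasseDeriv_le P n).trans_lt (by omega)
  simp [taylor_coeff, eval_eq_sum_range' hdeg, sum_range_succ, hasseDeriv_coeff, add_comm 1 n]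

theorem sum_powerset_neg_one_pow_mul_eval (s : Finset ι) (a : ι → R) (P : R[X])
    (hP : P.natDegree ≤ #s) (x : R) :
    ∑ t ∈ s.powerset, (-1) ^ (#s - #t) * P.eval (x + ∑ m ∈ t, a m) =
      (#s).factorial * P.coeff #s * ∏ m ∈ s, a m := by
  classical
  induction s using Finset.induction_on generalizing P with
  | empty =>
    rw [eq_C_of_natDegree_le_zero hP]
    simp
  | insert m s hm ih =>
    rw [card_insert_of_notMem hm] at hP ⊢
    have hdiff (t) (ht : t ∈ s.powerset) :
        (-1) ^ (#s + 1 - #t) * P.eval (x + ∑ m ∈ t, a m) +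
          (-1) ^ (#s + 1 - #(insert m t)) * P.eval (x + ∑ m ∈ insert m t, a m) =
        (-1) ^ (#s - #t) * (taylor (a m) P - P).eval (x + ∑ m ∈ t, a m) := by
      have hts := mem_powerset.1 ht
      have hmt : m ∉ t := fun h => hm (hts h)
      rw [card_insert_of_notMem hmt, sum_insert hmt, Nat.add_sub_add_right,
        Nat.sub_add_comm (card_le_card hts), pow_succ, eval_sub, taylor_eval, add_assoc x,
        add_comm (∑ m ∈ t, a m)]
      ring
    rw [sum_powerset_insert hm, ← sum_add_distrib, sum_congr rfl hdiff,
      ih _ (natDegree_taylor_sub_le P _ hP), coeff_taylor_sub P _ hP, prod_insert hm,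
      Nat.factorial_succ]
    push_cast
    ring

theorem sum_neg_one_pow_mul_eval_sum [Fintype ι] (a : ι → R) (P : R[X])
    (hP : P.natDegree = Fintype.card ι) :
    ∑ t : Finset ι, (-1) ^ (Fintype.card ι - #t) * P.eval (∑ m ∈ t, a m) =
      (Fintype.card ι).factorial * P.leadingCoeff * ∏ m, a m := by
  have h := sum_powerset_neg_one_pow_mul_eval univ a P hP.le 0
  simpa only [powerset_univ, zero_add, card_univ, ← hP, leadingCoeff] using h

end FiniteDifference

section LeadingForm

open Polynomial

variable {R σ : Type*} [CommSemiring R]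

theorem coeff_aeval_C_mul_X (p : MvPolynomial σ R) (w : σ → R) (n : ℕ) :
    (MvPolynomial.aeval (fun m => C (w m) * X) p : R[X]).coeff n =
      MvPolynomial.eval w (MvPolynomial.homogeneousComponent n p) := by
  induction p using MvPolynomial.induction_on' with
  | monomial e c =>
    have hline : (MvPolynomial.aeval (fun m => C (w m) * X) (MvPolynomial.monomial e c) : R[X]) =
        C (c * e.prod fun m k => w m ^ k) * X ^ e.degree := by
      rw [MvPolynomial.aeval_monomial]
      simp only [mul_pow, Finsupp.prod_mul, map_mul, map_finsuppProd, map_pow, mul_assoc]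
      congr 2
      exact prod_pow_eq_pow_sum ..
    rw [hline, MvPolynomial.homogeneousComponent_of_mem
      ((MvPolynomial.mem_homogeneousSubmodule _ _).2 (MvPolynomial.isHomogeneous_monomial c rfl))]
    split_ifs with h
    · rw [MvPolynomial.eval_monomial, coeff_C_mul, coeff_X_pow, if_pos h, mul_one]
    · rw [map_zero, coeff_C_mul, coeff_X_pow, if_neg h, mul_zero]
  | add p q hp hq => simp [hp, hq]

theorem natDegree_aeval_C_mul_X_le (p : MvPolynomial σ R) (w : σ → R) :
    (MvPolynomial.aeval (fun m => C (w m) * X) p : R[X]).natDegree ≤ p.totalDegree := by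
  refine natDegree_le_iff_coeff_eq_zero.2 fun n hn => ?_
  rw [coeff_aeval_C_mul_X, MvPolynomial.homogeneousComponent_eq_zero _ _ hn, map_zero]

theorem eval_aeval (p : MvPolynomial σ R) (q : σ → R[X]) (r : R) :
    (MvPolynomial.aeval q p : R[X]).eval r = MvPolynomial.eval (fun m => (q m).eval r) p :=
  MvPolynomial.comp_aeval_apply q (Polynomial.aeval (R := R) r) p

theorem homogeneousComponent_totalDegree_ne_zero {p : MvPolynomial σ R} (hp : p ≠ 0) :
    MvPolynomial.homogeneousComponent p.totalDegree p ≠ 0 := by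
  obtain ⟨e, he, hdeg⟩ := exists_mem_eq_sup p.support (MvPolynomial.support_nonempty.2 hp)
    fun s => s.sum fun _ e => e
  refine MvPolynomial.ne_zero_iff.2 ⟨e, ?_⟩
  rw [MvPolynomial.coeff_homogeneousComponent,
    if_pos (show e.degree = p.totalDegree from hdeg.symm)]
  exact MvPolynomial.mem_support_iff.1 he

end LeadingForm

section Factorial

variable {F : Type*} [Field F] {d : ℕ}

theorem natCast_factorial_ne_zero_of_lt_ringChar (h : ringChar F = 0 ∨ d < ringChar F) :
    (d.factorial : F) ≠ 0 := by
  rcases h with h | h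
  · have : CharZero F := (CharP.ringChar_zero_iff_CharZero F).1 h
    exact mod_cast d.factorial_ne_zero
  · have : Fact (ringChar F).Prime :=
      ⟨(CharP.char_is_prime_or_zero F (ringChar F)).resolve_right (by omega)⟩
    exact ((IsUnit.natCast_factorial_iff_of_charP (A := F) (ringChar F)).2 h).ne_zero

theorem natCast_le_mk_of_natCast_factorial_ne_zero (h : (d.factorial : F) ≠ 0) :
    (d : Cardinal) ≤ Cardinal.mk F := by
  rcases finite_or_infinite F with hF | hF
  · have := Fintype.ofFinite F
    rw [← Nat.cast_card, Nat.cast_le, Nat.card_eq_fintype_card]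
    by_contra! hlt
    have hdvd := Nat.cast_dvd_cast (α := F) (Nat.dvd_factorial Fintype.card_pos hlt.le)
    rw [Nat.cast_card_eq_zero, zero_dvd_iff] at hdvd
    exact h hdvd
  · exact Cardinal.natCast_le_aleph0.trans (Cardinal.infinite_iff.1 hF)

end Factorial

section PolyMap

variable {F V U : Type*} [Field F] [AddCommGroup V] [Module F V] [AddCommGroup U] [Module F U]
  {M L : ℕ} {b : Basis (Fin M) F V} {c : Basis (Fin L) F U} {p : Fin L → MvPolynomial (Fin M) F}

theorem repr_polyMap (v : V) (l : Fin L) :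
    c.repr (polyMap b c p v) l = MvPolynomial.eval (b.repr v) (p l) := by
  simp [polyMap, Finsupp.single_apply]

theorem polyDegree_pos_of_ne {x y : V} (h : polyMap b c p x ≠ polyMap b c p y) :
    0 < polyDegree p := by
  by_contra h₀
  have hconst (l : Fin L) : (p l).totalDegree = 0 :=
    Nat.le_zero.1 <| (le_sup (f := fun l => (p l).totalDegree) (mem_univ l)).trans (not_lt.1 h₀)
  refine h (c.ext_elem fun l => ?_)
  rw [repr_polyMap, repr_polyMap, MvPolynomial.totalDegree_eq_zero_iff_eq_C.1 (hconst l),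
    MvPolynomial.eval_C, MvPolynomial.eval_C]

theorem exists_coord_polyMap_smul_eq_eval (b : Basis (Fin M) F V) (c : Basis (Fin L) F U)
    (hd : 0 < polyDegree p) (hcard : (polyDegree p : Cardinal) ≤ Cardinal.mk F) :
    ∃ (x : V) (l : Fin L) (P : Polynomial F), P.natDegree = polyDegree p ∧
      ∀ r : F, c.coord l (polyMap b c p (r • x)) = P.eval r := by
  have hne : (univ : Finset (Fin L)).Nonempty := by
    by_contra h
    simp [polyDegree, not_nonempty_iff_eq_empty.1 h] at hd
  obtain ⟨l, -, hl⟩ : ∃ l ∈ univ, polyDegree p = (p l).totalDegree :=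
    exists_mem_eq_sup univ hne fun l => (p l).totalDegree
  rw [hl] at hd hcard ⊢
  have hlead := homogeneousComponent_totalDegree_ne_zero (p := p l) fun h => by simp [h] at hd
  obtain ⟨w, hw⟩ : ∃ w, MvPolynomial.eval w
      (MvPolynomial.homogeneousComponent (p l).totalDegree (p l)) ≠ 0 := by
    by_contra! h
    exact hlead ((MvPolynomial.homogeneousComponent_isHomogeneous _
      (p l)).eq_zero_of_forall_eval_eq_zero_of_le_card h hcard)
  refine ⟨b.equivFun.symm w, l, MvPolynomial.aeval
    (fun m => Polynomial.C (w m) * Polynomial.X) (p l), ?_, fun r => ?_⟩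
  · refine Polynomial.natDegree_eq_of_le_of_coeff_ne_zero (natDegree_aeval_C_mul_X_le _ w) ?_
    rwa [coeff_aeval_C_mul_X]
  · have hrepr (m : Fin M) : b.repr (r • b.equivFun.symm w) m = w m * r := by
      rw [← map_smul, ← b.equivFun_apply, LinearEquiv.apply_symm_apply, Pi.smul_apply,
        smul_eq_mul, mul_comm]
    simp only [c.coord_apply, repr_polyMap, eval_aeval, Polynomial.eval_mul, Polynomial.eval_C,
      Polynomial.eval_X, ← funext hrepr]

end PolyMap

namespace LinearEncoder

variable {F V U : Type*} [Field F] [AddCommGroup V] [Module F V] [AddCommGroup U] [Module F U]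
  {K N S A T d : ℕ} {E : LinearEncoder F K N}

theorem encode_zero (i : Fin N) : E.encode (0 : Fin K → V) 0 i = 0 := by
  simp [encode]

theorem Achieves.inRegion_of_multilinearMap {W : Fin d → Type*} [∀ j, AddCommGroup (W j)]
    [∀ j, Module F (W j)] {f : MultilinearMap F W U} {D : Set (Decoder K N U)}
    (hE : E.Achieves.{w} D (fun x => f x) S A T) (hK : 0 < K) (hd : 0 < d) (hf : f ≠ 0)
    (hT : 0 < T → Finite (∀ j, W j)) : InRegion N K d S A T := by
  have : Nonempty (Fin d) := ⟨⟨0, hd⟩⟩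
  obtain ⟨x, hx⟩ : ∃ x, f x ≠ 0 := by
    by_contra! h
    exact hf (MultilinearMap.ext h)
  have : Nontrivial (∀ j, W j) := ⟨x, 0, fun h => hx (h ▸ f.map_zero)⟩
  by_contra hreg
  obtain ⟨j, R, hR, hcov⟩ := hE.exists_coveredAvoiding hK hd hT hreg
  obtain ⟨a, ha, ha₀⟩ := hcov.exists_dual
  let φ := LinearMap.pi fun m => (a m).smulRight (x m)
  have hφ (z) : f (φ z) = (∏ m, a m z) • f x := f.map_smul_univ (fun m => a m z) x
  obtain ⟨Z, hZ⟩ := E.exists_encode_eq φ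
  have hsilent (i : Fin N) (hi : i ∈ R) :
      f (E.encode (fun k => φ (E.dataVector k)) Z i) = f (E.encode 0 0 i) := by
    obtain ⟨m, hm⟩ := ha₀ _ (Set.mem_image_of_mem _ hi)
    rw [hZ, hφ, prod_eq_zero (mem_univ m) hm, zero_smul, encode_zero, f.map_zero]
  have h := hE.determinesOutputs R hR _ 0 Z 0 hsilent j
  simp only [hφ, ha, prod_const_one, one_smul] at h
  exact hx (h.trans f.map_zero)

theorem Achieves.exists_linear_recovery {f : V → U}
    (hE : E.Achieves.{w} (linearDecoders F K N U) f S A T) {R : Finset (Fin N)} (hR : N ≤ #R + S)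
    {σ : Type*} [Countable σ] (X : σ → Fin K → V) (Z : σ → Fin E.numKeys → V) :
    ∃ c : Fin K → R → F, ∀ s k, f (X s k) = ∑ i, c k i • f (E.encode (X s) (Z s) i) := by
  obtain ⟨-, -, Ω, _, P, h, _, hlin, hdec⟩ := hE
  have hall : ∀ᵐ ω ∂P, ∀ s, h ω R (fun i => f (E.encode (X s) (Z s) i)) = fun k => f (X s k) :=
    ae_all_iff.2 fun s => hdec (X s) (Z s) R hR _ (by simp)
  obtain ⟨ω, hω⟩ := hall.exists
  obtain ⟨c, hc⟩ := hlin ω R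
  exact ⟨c, fun s k => (congrFun (hω s) k).symm.trans (hc _ k)⟩

theorem Achieves.inRegion_of_eval_line [Nontrivial V] {f : V → U}
    (hE : E.Achieves.{w} (linearDecoders F K N U) f S 0 T) (hK : 0 < K)
    (hT : 0 < T → Finite V) (g : Dual F U) (x : V) {P : Polynomial F} (hP₀ : 0 < P.natDegree)
    (hfact : (P.natDegree.factorial : F) ≠ 0) (hP : ∀ r : F, g (f (r • x)) = P.eval r) :
    InRegion N K P.natDegree S 0 T := by
  by_contra hreg
  obtain ⟨j, R, hR, hcov⟩ := hE.exists_coveredAvoiding hK hP₀ hT hreg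
  obtain ⟨a, ha, ha₀⟩ := hcov.exists_dual
  let φ (t : Finset (Fin P.natDegree)) := (∑ m ∈ t, a m).smulRight x
  have hφ (t z) : g (f (φ t z)) = P.eval (∑ m ∈ t, a m z) := by simp [φ, hP]
  choose Z hZ using fun t => E.exists_encode_eq (φ t)
  obtain ⟨c, hc⟩ := hE.exists_linear_recovery hR (fun t k => φ t (E.dataVector k)) Z
  have hrec (t) : P.eval (∑ m ∈ t, a m (E.dataVector j)) =
      ∑ i, c j i * P.eval (∑ m ∈ t, a m (E.workerVector i)) := by
    simp only [← hφ, hc t j, hZ, map_sum, map_smul, smul_eq_mul]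
  have hdiff (z) : ∑ t, (-1) ^ (P.natDegree - #t) * P.eval (∑ m ∈ t, a m z) =
      P.natDegree.factorial * P.leadingCoeff * ∏ m, a m z := by
    simpa only [Fintype.card_fin] using
      sum_neg_one_pow_mul_eval_sum (fun m => a m z) P (Fintype.card_fin _).symm
  have hlead : (P.natDegree.factorial : F) * P.leadingCoeff = 0 := by
    calc (P.natDegree.factorial : F) * P.leadingCoeff
        = ∑ t, (-1) ^ (P.natDegree - #t) * P.eval (∑ m ∈ t, a m (E.dataVector j)) := by
          rw [hdiff, prod_eq_one fun m _ => ha m, mul_one]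
      _ = ∑ i, c j i *
          ∑ t, (-1) ^ (P.natDegree - #t) * P.eval (∑ m ∈ t, a m (E.workerVector i)) := by
          simp only [hrec, mul_sum]
          rw [sum_comm]
          simp only [mul_left_comm]
      _ = 0 := sum_eq_zero fun i _ => by
          obtain ⟨m, hm⟩ := ha₀ _ (Set.mem_image_of_mem _ i.2)
          rw [hdiff, prod_eq_zero (mem_univ m) hm, mul_zero, mul_zero]
  have hP_ne : P ≠ 0 := fun h => by simp [h] at hP₀
  exact mul_ne_zero hfact (Polynomial.leadingCoeff_ne_zero.2 hP_ne) hlead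

theorem Achieves.inRegion_of_polyMap {M L : ℕ} {b : Basis (Fin M) F V} {c : Basis (Fin L) F U}
    {p : Fin L → MvPolynomial (Fin M) F}
    (hE : E.Achieves.{w} (linearDecoders F K N U) (polyMap b c p) S 0 T) (hK : 0 < K)
    (hT : 0 < T → Finite V) (hne : ∃ x y, polyMap b c p x ≠ polyMap b c p y)
    (hfact : ((polyDegree p).factorial : F) ≠ 0) : InRegion N K (polyDegree p) S 0 T := by
  obtain ⟨x, y, hxy⟩ := hne
  have : Nontrivial V := ⟨x, y, fun h => hxy (h ▸ rfl)⟩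
  have hd := polyDegree_pos_of_ne hxy
  obtain ⟨x, l, P, hP, heval⟩ := exists_coord_polyMap_smul_eq_eval b c hd
    (natCast_le_mk_of_natCast_factorial_ne_zero hfact)
  rw [← hP] at hd hfact ⊢
  exact hE.inRegion_of_eval_line hK hT (c.coord l) x hd hfact heval

end LinearEncoder

section PolynomialCurves

open Polynomial

variable {F V U : Type*} [Field F] [AddCommGroup V] [Module F V] [AddCommGroup U] [Module F U]

theorem eval_eq_sum_basis_mul_eval {ι : Type*} [DecidableEq ι] {s : Finset ι} {α : ι → F}
    (hα : Set.InjOn α s) {P : F[X]} (hP : P.degree < #s) (t : F) :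
    P.eval t = ∑ i ∈ s, (Lagrange.basis s α i).eval t * P.eval (α i) := by
  conv_lhs => rw [Lagrange.eq_interpolate hα hP, Lagrange.interpolate_apply]
  simp only [eval_finsetSum, eval_mul, eval_C, mul_comm]

/-- The polynomial functions of degree at most `D` from the line to `U`, namely the functions
`t ↦ ∑ k ≤ D, t ^ k • u k`. -/
def polyCurves (F U : Type*) [Field F] [AddCommGroup U] [Module F U] (D : ℕ) :
    Submodule F (F → U) :=
  LinearMap.range <| LinearMap.pi fun t : F =>
    ∑ k : Fin (D + 1), t ^ (k : ℕ) • LinearMap.proj (R := F) (φ := fun _ => U) k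

theorem mem_polyCurves {D : ℕ} {g : F → U} :
    g ∈ polyCurves F U D ↔
      ∃ u : Fin (D + 1) → U, ∀ t, g t = ∑ k : Fin (D + 1), t ^ (k : ℕ) • u k := by
  simp [polyCurves, LinearMap.mem_range, funext_iff, eq_comm]

theorem eval_smul_mem_polyCurves {D : ℕ} {P : F[X]} (hP : P.natDegree ≤ D) (x : U) :
    (fun t => P.eval t • x) ∈ polyCurves F U D := by
  refine mem_polyCurves.2 ⟨fun k => P.coeff k • x, fun t => ?_⟩
  rw [eval_eq_sum_range' (Nat.lt_succ_of_le hP), ← Fin.sum_univ_eq_sum_range, sum_smul]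
  simp only [smul_smul, mul_comm]

theorem eq_sum_basis_smul_of_mem_polyCurves {D : ℕ} {g : F → U} (hg : g ∈ polyCurves F U D)
    {ι : Type*} [DecidableEq ι] {s : Finset ι} {α : ι → F} (hα : Set.InjOn α s) (hD : D < #s)
    (t : F) : g t = ∑ i ∈ s, (Lagrange.basis s α i).eval t • g (α i) := by
  obtain ⟨u, hu⟩ := mem_polyCurves.1 hg
  have hpow (k : Fin (D + 1)) :
      t ^ (k : ℕ) = ∑ i ∈ s, (Lagrange.basis s α i).eval t * α i ^ (k : ℕ) := by
    simpa using eval_eq_sum_basis_mul_eval hα (P := X ^ (k : ℕ))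
      ((degree_X_pow_le _).trans_lt (by exact_mod_cast k.is_le.trans_lt hD)) t
  simp only [hu, smul_sum, smul_smul]
  rw [sum_comm]
  simp only [← sum_smul, ← hpow]

/-- The maps of degree at most `d` in the sense that they turn polynomial curves of degree at most
`n` into polynomial curves of degree at most `n * d`; this is all that interpolation needs. -/
def HasDegreeLE (F : Type*) {V U : Type*} [Field F] [AddCommGroup V] [Module F V] [AddCommGroup U]
    [Module F U] (f : V → U) (d : ℕ) : Prop :=
  ∀ ⦃n : ℕ⦄ ⦃g : F → V⦄, g ∈ polyCurves F V n → (fun t => f (g t)) ∈ polyCurves F U (n * d)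

theorem hasDegreeLE_multilinearMap {ι : Type*} [Fintype ι] {W : ι → Type*}
    [∀ i, AddCommGroup (W i)] [∀ i, Module F (W i)] (f : MultilinearMap F W U) :
    HasDegreeLE F (fun x => f x) (Fintype.card ι) := by
  classical
  intro n g hg
  obtain ⟨u, hu⟩ := mem_polyCurves.1 hg
  have hexpand : (fun t => f (g t)) = ∑ r : ι → Fin (n + 1),
      fun t => (X ^ ∑ i, (r i : ℕ) : F[X]).eval t • f fun i => u (r i) i := by
    funext t
    have hgt : g t = fun i => ∑ k : Fin (n + 1), t ^ (k : ℕ) • u k i := by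
      rw [hu]
      ext i
      simp
    rw [hgt, f.map_sum, Finset.sum_apply]
    simp only [f.map_smul_univ, prod_pow_eq_pow_sum, eval_pow, eval_X]
  rw [hexpand]
  refine sum_mem fun r _ => eval_smul_mem_polyCurves ?_ _
  calc (X ^ ∑ i, (r i : ℕ) : F[X]).natDegree ≤ ∑ i, (r i : ℕ) := natDegree_X_pow_le _
    _ ≤ Fintype.card ι • n := sum_le_card_nsmul _ _ _ fun i _ => (r i).is_le
    _ = n * Fintype.card ι := by rw [smul_eq_mul, mul_comm]

theorem hasDegreeLE_polyMap {M L : ℕ} (b : Basis (Fin M) F V) (c : Basis (Fin L) F U)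
    (p : Fin L → MvPolynomial (Fin M) F) : HasDegreeLE F (polyMap b c p) (polyDegree p) := by
  intro n g hg
  obtain ⟨u, hu⟩ := mem_polyCurves.1 hg
  let q (m : Fin M) : F[X] := ∑ k : Fin (n + 1), C (b.repr (u k) m) * X ^ (k : ℕ)
  have hq (m : Fin M) : (q m).natDegree ≤ n :=
    natDegree_sum_le_of_forall_le _ _ fun k _ => (natDegree_C_mul_X_pow_le _ _).trans k.is_le
  have hq_eval (t : F) (m : Fin M) : (q m).eval t = b.repr (g t) m := by
    simp only [q, hu, eval_finsetSum, eval_mul, eval_C, eval_pow, eval_X, map_sum, map_smul,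
      Finsupp.coe_finsetSum, Finset.sum_apply, Finsupp.smul_apply, smul_eq_mul, mul_comm]
  have hexpand : (fun t => polyMap b c p (g t)) =
      ∑ l, fun t => (MvPolynomial.aeval q (p l)).eval t • c l := by
    funext t
    simp only [Finset.sum_apply, eval_aeval, hq_eval, polyMap]
  rw [hexpand, mul_comm]
  exact sum_mem fun l _ => eval_smul_mem_polyCurves (MvPolynomial.aeval_natDegree_le (p l)
    (le_sup (f := fun l => (p l).totalDegree) (mem_univ l)) q hq) _

end PolynomialCurves

section LagrangeCurve

open Polynomial

variable {F V ι : Type*} [Field F] [AddCommGroup V] [Module F V] [Fintype ι] [DecidableEq ι]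
  {β : ι → F}

/-- The polynomial curve that takes the values `x` at the nodes `β`. -/
noncomputable def lagrangeCurve (β : ι → F) (x : ι → V) (t : F) : V :=
  ∑ j, (Lagrange.basis univ β j).eval t • x j

theorem lagrangeCurve_node (hβ : Function.Injective β) (x : ι → V) (j : ι) :
    lagrangeCurve β x (β j) = x j := by
  rw [lagrangeCurve, sum_eq_single j _ (by simp), Lagrange.eval_basis_self hβ.injOn (mem_univ j),
    one_smul]
  intro k _ hk
  rw [Lagrange.eval_basis_of_ne hk (mem_univ j), zero_smul]

theorem lagrangeCurve_mem_polyCurves (hβ : Function.Injective β) (x : ι → V) :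
    lagrangeCurve β x ∈ polyCurves F V (Fintype.card ι - 1) := by
  have hsum : lagrangeCurve β x = ∑ j, fun t => (Lagrange.basis univ β j).eval t • x j := by
    funext t
    rw [Finset.sum_apply, lagrangeCurve]
  rw [hsum]
  exact sum_mem fun j _ => eval_smul_mem_polyCurves
    (natDegree_le_of_degree_le (Lagrange.degree_basis hβ.injOn (mem_univ j)).le) _

end LagrangeCurve

section LagrangeEncoder

variable {F V U : Type*} [Field F] [AddCommGroup V] [Module F V] [AddCommGroup U] [Module F U]
  {K N T d r S A : ℕ} {α : Fin N → F} {β : Fin K ⊕ Fin T → F}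

theorem lagrangeEncoder_encode (α : Fin N → F) (β : Fin K ⊕ Fin T → F) (X : Fin K → V)
    (Z : Fin T → V) (i : Fin N) :
    (lagrangeEncoder α β).encode X Z i = lagrangeCurve β (Sum.elim X Z) (α i) := by
  rw [lagrangeCurve, Fintype.sum_sum_type]
  rfl

theorem IsStandardPoints.hasLinearRecovery (hpts : IsStandardPoints α β) {f : V → U}
    (hf : HasDegreeLE F f d) (hN : (K + T - 1) * d + r + 1 ≤ N) :
    (lagrangeEncoder α β).HasLinearRecovery f r := by
  obtain ⟨hα, hβ, -⟩ := hpts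
  refine fun R hR =>
    ⟨fun k i => (Lagrange.basis R α i).eval (β (.inl k)), fun X (Z : Fin T → V) k => ?_⟩
  have hcurve := hf (lagrangeCurve_mem_polyCurves hβ (Sum.elim X Z))
  rw [Fintype.card_sum, Fintype.card_fin, Fintype.card_fin] at hcurve
  simpa only [lagrangeEncoder_encode, lagrangeCurve_node hβ, Sum.elim_inl] using
    eq_sum_basis_smul_of_mem_polyCurves hcurve hα.injOn (s := R) (by omega) (β (.inl k))

theorem IsUncodedPoints.hasLinearRecovery (hpts : IsUncodedPoints α β) (hK : 0 < K) (f : V → U)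
    (hN : K * (r + 1) ≤ N) : (lagrangeEncoder α β).HasLinearRecovery f r := by
  classical
  obtain ⟨hβ, σ, hσ, hcard⟩ := hpts
  intro R hR
  have hmeet (k : Fin K) : ∃ i ∈ R, σ i = k := by
    by_contra! hne
    have hle : {i | σ i = k}.ncard ≤ #Rᶜ := by
      rw [← Set.ncard_coe_finset]
      exact Set.ncard_le_ncard fun i hi => by simpa using fun hiR => hne i hiR hi
    have hdiv : r + 1 ≤ N / K := (Nat.le_div_iff_mul_le hK).2 (by rwa [mul_comm])
    have := (hcard k).1
    rw [card_compl, Fintype.card_fin] at hle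
    omega
  choose i hiR hi using hmeet
  refine ⟨fun k => Pi.single (i k) 1, fun X (Z : Fin T → V) k => ?_⟩
  have hstored : (lagrangeEncoder α β).encode X Z (i k) = X k := by
    rw [lagrangeEncoder_encode, hσ, hi, lagrangeCurve_node hβ, Sum.elim_inl]
  rw [sum_eq_single_of_mem (i k) (hiR k) fun j _ hj => by simp [hj]]
  simpa using congrArg f hstored.symm

theorem IsLCCPoints.hasLinearRecovery (hpts : IsLCCPoints d α β) (hK : 0 < K) {f : V → U}
    (hf : HasDegreeLE F f d) (h : InRegion N K d S A T) :
    (lagrangeEncoder α β).HasLinearRecovery f (S + 2 * A) := by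
  rw [IsLCCPoints] at hpts
  rw [InRegion] at h
  split_ifs at hpts h
  · exact hpts.hasLinearRecovery hf (by omega)
  · exact hpts.hasLinearRecovery hK f h

open Polynomial in
theorem IsStandardPoints.lagrangeEncoder_isPrivate [Finite V] (hpts : IsStandardPoints α β)
    (hT : 0 < T) : (lagrangeEncoder α β).IsPrivate V T := by
  classical
  obtain ⟨hα, hβ, hαβ⟩ := hpts
  refine LinearEncoder.isPrivate_of_exists_key_shift _ fun C hC => ?_
  -- `P j` is the curve with `j`-th input `1` and keys `P j (β (.inr l))`, and it vanishes on `C`.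
  let node : Fin K ⊕ C → F := Sum.elim (fun j => β (.inl j)) fun i => α i
  have hnode : Function.Injective node :=
    (hβ.comp Sum.inl_injective).sumElim (hα.comp Subtype.val_injective)
      fun j i => (hαβ hT i j).symm
  let P (j : Fin K) : F[X] := Lagrange.basis univ node (.inl j)
  have hP_zero (j : Fin K) (i : C) : (P j).eval (α i) = 0 :=
    Lagrange.eval_basis_of_ne (v := node) (i := .inl j) (j := .inr i) Sum.inl_ne_inr (mem_univ _)
  have hP_data (j k : Fin K) : (P j).eval (β (.inl k)) = if k = j then 1 else 0 := by
    split_ifs with hkj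
    · rw [hkj]
      exact Lagrange.eval_basis_self hnode.injOn (mem_univ (Sum.inl j))
    · exact Lagrange.eval_basis_of_ne (v := node) (i := .inl j) (j := .inl k)
        (by simpa using Ne.symm hkj) (mem_univ _)
  have hP_deg (j : Fin K) : (P j).degree < #(univ : Finset (Fin K ⊕ Fin T)) := by
    rw [Lagrange.degree_basis hnode.injOn (mem_univ _), card_univ, card_univ, Nat.cast_lt]
    have := j.pos
    simp only [Fintype.card_sum, Fintype.card_fin, Fintype.card_coe]
    omega
  refine ⟨fun j l => (P j).eval (β (.inr l)), fun i hi j => ?_⟩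
  have h := eval_eq_sum_basis_mul_eval hβ.injOn (hP_deg j) (α i)
  rw [hP_zero j ⟨i, hi⟩, Fintype.sum_sum_type] at h
  simp only [hP_data, mul_ite, mul_one, mul_zero, sum_ite_eq', mem_univ, if_true] at h
  exact h.symm

theorem IsLCCPoints.lagrangeEncoder_isPrivate (hpts : IsLCCPoints d α β) (hK : 0 < K)
    (hT : 0 < T → Finite V) : (lagrangeEncoder α β).IsPrivate V T := by
  rcases T.eq_zero_or_pos with rfl | hT₀
  · exact LinearEncoder.isPrivate_zero _ hK
  · have := hT hT₀
    rw [IsLCCPoints, if_pos (.inl hT₀)] at hpts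
    exact hpts.lagrangeEncoder_isPrivate hT₀

theorem IsLCCPoints.achieves (hpts : IsLCCPoints d α β) (hK : 0 < K) {f : V → U}
    (hf : HasDegreeLE F f d) (hT : 0 < T → Finite V) (h : InRegion N K d S A T) :
    (lagrangeEncoder α β).Achieves.{w} Set.univ f S A T :=
  (hpts.hasLinearRecovery hK hf h).determinesOutputs.achieves (hT ∘ Nat.pos_of_ne_zero)
    (hpts.lagrangeEncoder_isPrivate hK hT)

theorem IsLCCPoints.achieves_linearDecoders (hpts : IsLCCPoints d α β) (hK : 0 < K) {f : V → U}
    (hf : HasDegreeLE F f d) (hT : 0 < T → Finite V) (h : InRegion N K d S 0 T) :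
    (lagrangeEncoder α β).Achieves.{w} (linearDecoders F K N U) f S 0 T :=
  (hpts.hasLinearRecovery hK hf h).achieves (hT ∘ Nat.pos_of_ne_zero)
    (hpts.lagrangeEncoder_isPrivate hK hT)

end LagrangeEncoder

section Points

variable {F : Type*} {N K T : ℕ}

theorem nonempty_embedding_of_card_le_enatCard {ι : Type*} [Fintype ι]
    (h : (Fintype.card ι : ℕ∞) ≤ ENat.card F) : Nonempty (ι ↪ F) := by
  rw [← Cardinal.lift_mk_le', Cardinal.mk_fintype, Cardinal.lift_natCast, Cardinal.nat_le_lift_iff]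
  exact Cardinal.natCast_le_toENat.1 h

theorem ncard_setOf_val_mod_eq (hK : 0 < K) (j : Fin K) :
    {i : Fin N | (⟨i % K, Nat.mod_lt _ hK⟩ : Fin K) = j}.ncard =
      N / K + if j < N % K then 1 else 0 := by
  rw [← Nat.mod_eq_of_lt j.is_lt, ← Nat.count_modEq_card _ hK, Nat.count_eq_card_filter_range,
    ← Set.ncard_coe_finset, ← Set.ncard_image_of_injective _ Fin.val_injective]
  congr 1
  ext n
  simp [Fin.ext_iff, Fin.exists_iff, Nat.ModEq, Nat.mod_eq_of_lt j.is_lt, and_comm]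

theorem exists_isUncodedPoints (hK : 0 < K) {β : Fin K ⊕ Fin T → F} (hβ : Function.Injective β)
    (N : ℕ) : ∃ α : Fin N → F, IsUncodedPoints α β := by
  let σ (i : Fin N) : Fin K := ⟨i % K, Nat.mod_lt _ hK⟩
  refine ⟨fun i => β (.inl (σ i)), hβ, σ, fun _ => rfl, fun j => ?_⟩
  rw [ncard_setOf_val_mod_eq hK, Nat.ceilDiv_eq_add_pred_div]
  refine ⟨Nat.le_add_right .., ?_⟩
  rw [Nat.le_div_iff_mul_le hK, add_mul]
  have := Nat.div_add_mod' N K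
  split_ifs <;> omega

theorem exists_isLCCPoints (hK : 0 < K) (hF : ((N + K + T : ℕ) : ℕ∞) ≤ ENat.card F)
    (d : ℕ) : ∃ (α : Fin N → F) (β : Fin K ⊕ Fin T → F), IsLCCPoints d α β := by
  obtain ⟨g⟩ : Nonempty (Fin N ⊕ (Fin K ⊕ Fin T) ↪ F) :=
    nonempty_embedding_of_card_le_enatCard (by simpa [add_assoc] using hF)
  have hβ : Function.Injective (g ∘ .inr) := g.injective.comp Sum.inr_injective
  unfold IsLCCPoints
  split_ifs
  · exact ⟨g ∘ .inl, g ∘ .inr, g.injective.comp Sum.inl_injective, hβ,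
      fun _ _ _ => g.injective.ne Sum.inl_ne_inr⟩
  · obtain ⟨α, hα⟩ := exists_isUncodedPoints hK hβ N
    exact ⟨α, _, hα⟩

end Points

end CodedComputing

theorem theorem2 {F : Type u} [Field F] {U : Type v'} [AddCommGroup U] [Module F U]
    (N K S T : ℕ) (hK : 0 < K) :
    -- multilinear functions, arbitrary decoding
    (∀ (A d : ℕ) (W : Fin d → Type v) [∀ j, AddCommGroup (W j)] [∀ j, Module F (W j)]
        (f : MultilinearMap F W U), 0 < d → f ≠ 0 → (0 < T → Finite (∀ j, W j)) →
      (∀ E : CodedComputing.LinearEncoder F K N,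
        E.Achieves.{w} Set.univ (fun x => f x) S A T → CodedComputing.InRegion N K d S A T) ∧
      (CodedComputing.InRegion N K d S A T →
        ∀ (α : Fin N → F) (β : Fin K ⊕ Fin T → F), CodedComputing.IsLCCPoints d α β →
          (CodedComputing.lagrangeEncoder α β).Achieves.{w} Set.univ (fun x => f x) S A T) ∧
      (((N + K + T : ℕ) : ℕ∞) ≤ ENat.card F →
        (∃ E : CodedComputing.LinearEncoder F K N,
          E.Achieves.{w} Set.univ (fun x => f x) S A T) →
        ∃ (α : Fin N → F) (β : Fin K ⊕ Fin T → F), CodedComputing.IsLCCPoints d α β ∧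
          (CodedComputing.lagrangeEncoder α β).Achieves.{w} Set.univ (fun x => f x) S A T)) ∧
    -- arbitrary polynomials, no adversary, linear decoding
    (∀ (V : Type v) [AddCommGroup V] [Module F V] (M L : ℕ)
        (b : Module.Basis (Fin M) F V) (c : Module.Basis (Fin L) F U)
        (p : Fin L → MvPolynomial (Fin M) F) (f : V → U) (d : ℕ),
        CodedComputing.IsCanonical p → f = CodedComputing.polyMap b c p →
        d = CodedComputing.polyDegree p → (∃ x y, f x ≠ f y) →
        (ringChar F = 0 ∨ d < ringChar F) → (0 < T → Finite V) →
      (∀ E : CodedComputing.LinearEncoder F K N,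
        E.Achieves.{w} (CodedComputing.linearDecoders F K N U) f S 0 T →
          CodedComputing.InRegion N K d S 0 T) ∧
      (CodedComputing.InRegion N K d S 0 T →
        ∀ (α : Fin N → F) (β : Fin K ⊕ Fin T → F), CodedComputing.IsLCCPoints d α β →
          (CodedComputing.lagrangeEncoder α β).Achieves.{w}
            (CodedComputing.linearDecoders F K N U) f S 0 T) ∧
      (((N + K + T : ℕ) : ℕ∞) ≤ ENat.card F →
        (∃ E : CodedComputing.LinearEncoder F K N,
          E.Achieves.{w} (CodedComputing.linearDecoders F K N U) f S 0 T) →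
        ∃ (α : Fin N → F) (β : Fin K ⊕ Fin T → F), CodedComputing.IsLCCPoints d α β ∧
          (CodedComputing.lagrangeEncoder α β).Achieves.{w}
            (CodedComputing.linearDecoders F K N U) f S 0 T)) := by
  refine ⟨fun A d W _ _ f hd hf hT => ?_, fun V _ _ M L b c p f d _ hfp hdp hne hchar hT => ?_⟩
  · have hconv (E : CodedComputing.LinearEncoder F K N)
        (hE : E.Achieves.{w} Set.univ (fun x => f x) S A T) :=
      hE.inRegion_of_multilinearMap hK hd hf hT
    have hdeg : CodedComputing.HasDegreeLE F (fun x => f x) d := by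
      simpa using CodedComputing.hasDegreeLE_multilinearMap f
    refine ⟨hconv, fun hreg α β hpts => hpts.achieves hK hdeg hT hreg, fun hF ⟨E, hE⟩ => ?_⟩
    obtain ⟨α, β, hpts⟩ := CodedComputing.exists_isLCCPoints hK hF d
    exact ⟨α, β, hpts, hpts.achieves hK hdeg hT (hconv E hE)⟩
  · subst hfp hdp
    have hfact := CodedComputing.natCast_factorial_ne_zero_of_lt_ringChar hchar
    have hconv (E : CodedComputing.LinearEncoder F K N)
        (hE : E.Achieves.{w} (CodedComputing.linearDecoders F K N U)
          (CodedComputing.polyMap b c p) S 0 T) :=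
      hE.inRegion_of_polyMap hK hT hne hfact
    have hdeg := CodedComputing.hasDegreeLE_polyMap b c p
    refine ⟨hconv, fun hreg α β hpts => hpts.achieves_linearDecoders hK hdeg hT hreg,
      fun hF ⟨E, hE⟩ => ?_⟩
    obtain ⟨α, β, hpts⟩ :=
      CodedComputing.exists_isLCCPoints hK hF (CodedComputing.polyDegree p)
    exact ⟨α, β, hpts, hpts.achieves_linearDecoders hK hdeg hT (hconv E hE)⟩
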